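/- Let $n\ge 1$, $2\le p_1\le\cdots\le p_n$ and $0<\lambda\le\Lambda$. For $r,M>0$ let $$K_r(M)=\{x\in\mathbb R^n:\ |x_i|\le r^{1/p_i}M^{-(p_n-p_i)/p_i}\ \text{ for } i=1,\dots,n\},$$ and for a real symmetric $n\times n$ matrix $A$ with eigenvalues $e_1,\dots,e_n$ (with multiplicity) let $\mathcal M^-(A)=\Lambda\sum_{e_i<0}e_i+\lambda\sum_{e_i>0}e_i$. Lemma. For any $\epsilon>0$ there exist $r_0\in(0,1)$, $M_0>1$ and $\delta_0\in(0,1)$, depending only on $n,(p_i),\lambda,\Lambda$ and $\epsilon$, such that $K_{r_0}(1)\subset K_1(M_0)$ and the following holds. If $u\in C(K_1(M_0))$ is nonnegative in $K_1(M_0)$ and satisfies $$\mathcal M^-\Big(\operatorname{diag}\big(|D_iu|^{\frac{p_i-2}{2}}\big)\,D^2u\,\operatorname{diag}\big(|D_iu|^{\frac{p_i-2}{2}}\big)\Big)-\Lambda\sum_{i=1}^n|D_iu|^{p_i-1}\le\epsilon$$ in the interior $\Omega$ of $K_1(M_0)$ in the viscosity sense (that is, whenever $x_0\in\Omega$, $\psi\in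 C^2(\Omega)$ and $u-\psi$ has a local minimum at $x_0$, this inequality holds at $x_0$ with $\psi$ in place of $u$; here $|t|^0=1$ for all $t$, including $t=0$), and if $$\inf_{K_{r_0}(1)}u\le 1,$$ then $$|\{u<M_0\}\cap K_1(M_0)|\ge\delta_0\,|K_1(M_0)|,$$ where $|\cdot|$ denotes Lebesgue measure. -/

import Mathlib

/-- The largest exponent `p_n` of the ordered family `p_1 ≤ ⋯ ≤ p_n`. -/
def lastExponent {n : ℕ} [NeZero n] (p : Fin n → ℝ) : ℝ :=
  p ⟨n - 1, Nat.sub_one_lt (NeZero.ne n)⟩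

/-- The (closed) intrinsic cube `K_r(M) = {x : |x_i| ≤ r ^ α_i * M ^ β_i for all i}` with
`α_i = 1 / p_i` and `β_i = -((p_n - p_i) / p_i)`. -/
def intrinsicCube {n : ℕ} [NeZero n] (p : Fin n → ℝ) (r M : ℝ) :
    Set (EuclideanSpace ℝ (Fin n)) :=
  {x | ∀ i, |x i| ≤ r ^ (1 / p i) * M ^ (-((lastExponent p - p i) / p i))}

open Classical in
/-- The Pucci operator `M⁻_{lam,Lam}(A) = Lam ∑_{e_i(A) < 0} e_i(A) + lam ∑_{e_i(A) > 0} e_i(A)`,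
where the `e_i(A)` are the eigenvalues of the real symmetric matrix `A`, with multiplicity.
(It is only ever evaluated at symmetric matrices; elsewhere it gets the value `0`.) -/
noncomputable def pucciMinus {n : ℕ} (lam Lam : ℝ) (A : Matrix (Fin n) (Fin n) ℝ) : ℝ :=
  if hA : A.IsHermitian then
    Lam * (∑ i with hA.eigenvalues i < 0, hA.eigenvalues i)
      + lam * (∑ i with 0 < hA.eigenvalues i, hA.eigenvalues i)
  else 0

/-- The partial derivative `D_i ψ (x)`. -/
noncomputable def partialDeriv {n : ℕ} (ψ : EuclideanSpace ℝ (Fin n) → ℝ)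
    (x : EuclideanSpace ℝ (Fin n)) (i : Fin n) : ℝ :=
  fderiv ℝ ψ x (EuclideanSpace.single i 1)

/-- The Hessian matrix `D²ψ (x)`. -/
noncomputable def hessianMatrix {n : ℕ} (ψ : EuclideanSpace ℝ (Fin n) → ℝ)
    (x : EuclideanSpace ℝ (Fin n)) : Matrix (Fin n) (Fin n) ℝ :=
  Matrix.of fun i j =>
    fderiv ℝ (fderiv ℝ ψ) x (EuclideanSpace.single i 1) (EuclideanSpace.single j 1)

/-- The matrix `diag(|D_i ψ|^((p_i-2)/2)) D²ψ diag(|D_i ψ|^((p_i-2)/2))` at `x`.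
For `p_i = 2` the diagonal entry is `1`, also where `D_i ψ` vanishes. -/
noncomputable def weightedHessian {n : ℕ} (p : Fin n → ℝ) (ψ : EuclideanSpace ℝ (Fin n) → ℝ)
    (x : EuclideanSpace ℝ (Fin n)) : Matrix (Fin n) (Fin n) ℝ :=
  Matrix.diagonal (fun i => |partialDeriv ψ x i| ^ ((p i - 2) / 2)) * hessianMatrix ψ x *
    Matrix.diagonal (fun i => |partialDeriv ψ x i| ^ ((p i - 2) / 2))

/-- At a point near which `ψ` is of class `C²`, the weighted Hessian is symmetric, so that
`pucciMinus` is evaluated there through eigenvalues. -/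
theorem weightedHessian_isHermitian {n : ℕ} (p : Fin n → ℝ)
    {ψ : EuclideanSpace ℝ (Fin n) → ℝ} {x : EuclideanSpace ℝ (Fin n)}
    (hψ : ContDiffAt ℝ 2 ψ x) : (weightedHessian p ψ x).IsHermitian := by
  have hs : IsSymmSndFDerivAt ℝ ψ x := hψ.isSymmSndFDerivAt (by simp)
  have hH : (hessianMatrix ψ x).transpose = hessianMatrix ψ x := by
    ext i j
    exact hs.eq _ _
  unfold Matrix.IsHermitian
  rw [Matrix.conjTranspose_eq_transpose_of_trivial]
  simp only [weightedHessian, Matrix.transpose_mul, Matrix.diagonal_transpose, hH,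
    Matrix.mul_assoc]

/-- For an open set `Ω`: the function `u ∈ C(Ω)` satisfies
`M⁻_{lam,Lam}(diag(|D_i u|^((p_i-2)/2)) D²u diag(|D_i u|^((p_i-2)/2))) - μ ∑_i |D_i u|^(p_i-1) ≤ c₀`
in `Ω` in the viscosity sense: whenever `ψ ∈ C²(Ω)` and `u - ψ` has a local minimum at a point
`x₀ ∈ Ω`, the inequality holds for `ψ` at `x₀`. -/
def IsViscositySupersolution {n : ℕ} (p : Fin n → ℝ) (lam Lam μ c₀ : ℝ)
    (Ω : Set (EuclideanSpace ℝ (Fin n))) (u : EuclideanSpace ℝ (Fin n) → ℝ) : Prop :=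
  ContinuousOn u Ω ∧
    ∀ x₀ ∈ Ω, ∀ ψ : EuclideanSpace ℝ (Fin n) → ℝ, ContDiffOn ℝ 2 ψ Ω →
      IsLocalMinOn (fun x => u x - ψ x) Ω x₀ →
        pucciMinus lam Lam (weightedHessian p ψ x₀)
          - μ * ∑ i, |partialDeriv ψ x₀ i| ^ (p i - 1) ≤ c₀

/-!
The lemma is a measure estimate of Alexandrov-Bakelman-Pucci type for contact sets. For `y` in a small
box around the origin, slide the function `-∑ i, h i (x i - y i)` from below until it touches `u`. The
profiles `h i` are so high near the boundary of the cube, and so low near the point where `u ≤ 1`, that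
contact takes place inside the cube and at points where `u < 3`. It therefore suffices to bound the
measure of the box of centres `y` by that of the set of contact points `x`. The constants need no care:
`M₀ = 3` will do, and all bounds may depend on the resulting cube.

At a contact point, `y` is determined by the gradient of `u`, namely `y i = x i + g i (D_i u)` with `g i`
the inverse of `h i'` up to sign. Formally the Jacobian of `x ↦ y` is
`det (1 + V D²u V)` with `V = diag ((h i'') ^ (-1 / 2))`. The profiles are chosen with
`h i'' = B / (|h i'| ^ (p i - 2) + η)`, so `V` is comparable with the weights of the equation. Contact
from below bounds `V D²u V` from below, and the equation then bounds it from above.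

This is made rigorous without second derivatives of `u`. First, `u` is replaced by its inf-convolution
`v` at a small scale `η`. Then `v` is a supersolution of the same inequality
(`infConv_supersolution`), and a test function touching it from below has `D_ii ψ ≤ 1 / η`; this pays
for the additional weight `η`, so the trace bound `hasTraceBound_infConv` is nondegenerate also
where a partial derivative vanishes. Second, a barrier (`barrier_contradiction`) shows that near each
contact point the relation between `x` and `y` is Lipschitz in the coordinates rescaled by `V`, with a
constant independent of `η` (`exists_rescale_lipschitz`). As the rescaling acts on both
sides, its determinant cancels, and a countable cover gives the measure bound
(`volume_le_of_locally_conjugate_lipschitz`). Finally `η` is taken so small that `v` and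
`u` differ by at most `1 / 2` at contact points.
-/

open Set Filter Topology MeasureTheory

/-! ### Touching profiles in one variable -/

/-- `h` is a one-dimensional touching profile with first derivative `σ`. The second derivative is
prescribed through the first, `h'' = B / (|h'| ^ (p - 2) + η)`, so that `h'` is the inverse of
`s ↦ ∫₀ˢ (|τ| ^ (p - 2) + η) / B`; for `η = 0` this would be the singular profile
`c |t| ^ (p / (p - 1))`, and `η > 0` makes `h` of class `C²`. The slope bound in
`abs_deriv_le` does not depend on `η`. -/
structure IsProfile (p η B : ℝ) (h σ : ℝ → ℝ) : Prop where
  hasDerivAt : ∀ t, HasDerivAt h (σ t) t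
  hasDerivAt_deriv : ∀ t, HasDerivAt σ (B / (|σ t| ^ (p - 2) + η)) t
  zero : h 0 = 0
  nonneg : ∀ t, 0 ≤ h t
  abs_deriv_le : ∀ t, |t| ≤ 2 → |σ t| ≤ 2 * B + 1

/-- Profiles exist for every `η ∈ (0, 1]`, and if `B` is large in terms of `L` and `p` only, they
are at least `4` outside `(-L / 2, L / 2)`, whatever `η` is. -/
theorem exists_isProfile {p η B L : ℝ} (hp : 2 ≤ p) (hη : 0 < η) (hη1 : η ≤ 1) (hB : 0 < B)
    (hL : 0 < L) (hBL : 4 * (16 / L) * ((16 / L) ^ (p - 2) + 1) ≤ L * B) :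
    ∃ h σ : ℝ → ℝ, IsProfile p η B h σ ∧ ∀ t, L / 2 ≤ |t| → 4 ≤ h t := by
  set f : ℝ → ℝ := fun s => (|s| ^ (p - 2) + η) / B with hf
  have hfc : Continuous f :=
    ((continuous_abs.rpow_const (fun _ => Or.inr (by linarith))).add continuous_const).div_const B
  have hpow (s : ℝ) : 0 ≤ |s| ^ (p - 2) := Real.rpow_nonneg (abs_nonneg s) _
  have hfpos (s : ℝ) : η / B ≤ f s := by
    simp only [hf]; gcongr; linarith [hpow s]
  have hηB : 0 < η / B := by positivity
  have hfi (a b : ℝ) : IntervalIntegrable f volume a b := hfc.intervalIntegrable a b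
  -- the inverse function of the slope
  set g : ℝ → ℝ := fun s => ∫ x in (0 : ℝ)..s, f x with hg
  have hg' (s : ℝ) : HasDerivAt g (f s) s :=
    intervalIntegral.integral_hasDerivAt_right (hfi 0 s)
      (hfc.stronglyMeasurableAtFilter _ _) hfc.continuousAt
  have hg0 : g 0 = 0 := by simp [hg]
  have hgodd (s : ℝ) : g (-s) = -g s := by
    have h1 := intervalIntegral.integral_comp_neg (a := 0) (b := s) f
    have h2 (x : ℝ) : f (-x) = f x := by simp [hf]
    simp_rw [h2] at h1
    rw [neg_zero] at h1
    change ∫ x in (0 : ℝ)..(-s), f x = -∫ x in (0 : ℝ)..s, f x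
    rw [h1, intervalIntegral.integral_symm]
  have hgc : Continuous g := continuous_iff_continuousAt.2 fun s => (hg' s).continuousAt
  have hgm : StrictMono g := strictMono_of_hasDerivAt_pos hg' fun s => hηB.trans_le (hfpos s)
  have hlow : ∀ s, 0 ≤ s → η / B * s ≤ g s := by
    intro s hs
    have := intervalIntegral.integral_mono_on hs (intervalIntegrable_const (c := η / B)) (hfi 0 s)
      fun x _ => hfpos x
    rw [intervalIntegral.integral_const, smul_eq_mul, sub_zero, mul_comm] at this
    exact this
  have hsurj : Function.Surjective g := by
    refine hgc.surjective ?_ ?_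
    · refine tendsto_atTop_mono' atTop ?_ (tendsto_id.const_mul_atTop hηB)
      filter_upwards [eventually_ge_atTop 0] with s hs using hlow s hs
    · refine tendsto_atBot_mono' atBot ?_ (tendsto_id.const_mul_atBot hηB)
      filter_upwards [eventually_le_atBot 0] with s hs
      have := hlow (-s) (by linarith)
      rw [hgodd] at this
      simp only [id]; linarith
  set e : ℝ ≃o ℝ := hgm.orderIsoOfSurjective g hsurj with he
  set σ : ℝ → ℝ := fun t => e.symm t with hσ
  have hgσ (t : ℝ) : g (σ t) = t := e.apply_symm_apply t
  have hσc : Continuous σ := e.symm.continuous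
  have hσm : StrictMono σ := e.symm.strictMono
  have hσ' (t : ℝ) : HasDerivAt σ (B / (|σ t| ^ (p - 2) + η)) t := by
    have := HasDerivAt.of_local_left_inverse hσc.continuousAt (hg' (σ t))
      (hηB.trans_le (hfpos _)).ne' (Eventually.of_forall hgσ)
    simpa [hf] using this
  have hσ0 : σ 0 = 0 := hgm.injective (by rw [hgσ, hg0])
  have hσodd (t : ℝ) : σ (-t) = -σ t := hgm.injective (by rw [hgσ, hgodd, hgσ])
  have hσi (a b : ℝ) : IntervalIntegrable σ volume a b := hσc.intervalIntegrable a b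
  set h : ℝ → ℝ := fun t => ∫ x in (0 : ℝ)..t, σ x with hh
  have hh' (t : ℝ) : HasDerivAt h (σ t) t :=
    intervalIntegral.integral_hasDerivAt_right (hσi 0 t)
      (hσc.stronglyMeasurableAtFilter _ _) hσc.continuousAt
  have hheven (t : ℝ) : h (-t) = h t := by
    have h1 := intervalIntegral.integral_comp_neg (a := 0) (b := t) σ
    have h2 : (fun x => σ (-x)) = fun x => -σ x := by funext x; exact hσodd x
    simp only [hh]
    rw [h2, neg_zero, intervalIntegral.integral_neg] at h1
    rw [intervalIntegral.integral_symm, ← h1, neg_neg]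
  have hσnn {t : ℝ} (ht : 0 ≤ t) : 0 ≤ σ t := hσ0 ▸ hσm.monotone ht
  have hhabs (t : ℝ) : h t = h |t| := by
    rcases abs_cases t with ⟨h1, _⟩ | ⟨h1, _⟩ <;> rw [h1]
    rw [hheven]
  have hhm : MonotoneOn h (Ici 0) := by
    refine monotoneOn_of_deriv_nonneg (convex_Ici 0)
      (fun t _ => (hh' t).continuousAt.continuousWithinAt)
      (fun t _ => (hh' t).differentiableAt.differentiableWithinAt) ?_
    intro t ht
    rw [interior_Ici] at ht
    rw [(hh' t).deriv]; exact hσnn (le_of_lt ht)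
  have hh0 : h 0 = 0 := by simp [hh]
  have hσabs (t : ℝ) : |σ t| = σ |t| := by
    rcases abs_cases t with ⟨h1, h2⟩ | ⟨h1, h2⟩ <;> rw [h1]
    · exact abs_of_nonneg (hσnn h2)
    · rw [hσodd]; exact abs_of_nonpos (by have := hσm h2; linarith)
  refine ⟨h, σ, ⟨hh', hσ', hh0, fun t => ?_, fun t ht => ?_⟩, fun t ht => ?_⟩
  · rw [hhabs, ← hh0]; exact hhm (mem_Ici.2 le_rfl) (abs_nonneg t) (abs_nonneg t)
  · rw [hσabs]
    by_contra! hc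
    have h1 := hgm hc
    rw [hgσ] at h1
    -- the weight is at least `1` on `[1, ∞)`, hence `g (2 * B + 1) ≥ 2`
    have h2 : ∫ x in (1 : ℝ)..(2 * B + 1), (1 / B : ℝ) ≤ ∫ x in (1 : ℝ)..(2 * B + 1), f x := by
      refine intervalIntegral.integral_mono_on (by linarith) intervalIntegrable_const (hfi _ _) ?_
      intro x hx
      have : 1 ≤ |x| ^ (p - 2) :=
        Real.one_le_rpow (by rw [abs_of_nonneg (by linarith [hx.1])]; exact hx.1) (by linarith)
      simp only [hf]; gcongr; linarith
    have h3 : g (2 * B + 1) = g 1 + ∫ x in (1 : ℝ)..(2 * B + 1), f x :=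
      (intervalIntegral.integral_add_adjacent_intervals (hfi _ _) (hfi _ _)).symm
    have h4 : 0 ≤ g 1 := le_trans (by positivity) (hlow 1 zero_le_one)
    have h5 : ∫ x in (1 : ℝ)..(2 * B + 1), (1 / B : ℝ) = 2 := by
      rw [intervalIntegral.integral_const, smul_eq_mul]; field_simp; ring
    linarith
  · rw [hhabs]
    set S := 16 / L with hS
    have hSpos : 0 < S := by positivity
    -- the slope at `L / 4` is at least `16 / L`
    have h1 : g S ≤ L / 4 := by
      have h2 : ∫ x in (0 : ℝ)..S, f x ≤ ∫ x in (0 : ℝ)..S, (S ^ (p - 2) + 1) / B := by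
        refine intervalIntegral.integral_mono_on hSpos.le (hfi _ _) intervalIntegrable_const ?_
        intro x hx
        simp only [hf]
        rw [abs_of_nonneg hx.1]
        have := Real.rpow_le_rpow hx.1 hx.2 (by linarith : (0 : ℝ) ≤ p - 2)
        gcongr
      rw [intervalIntegral.integral_const, smul_eq_mul, sub_zero] at h2
      refine h2.trans ?_
      rw [← mul_div_assoc, div_le_iff₀ hB]; linarith
    have h3 : S ≤ σ (L / 4) := by
      rw [← hgm.le_iff_le, hgσ]; exact h1
    have h4 : h (L / 2) ≤ h |t| := hhm (by simp; positivity) (abs_nonneg t) ht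
    have h5 : ∫ x in (L / 4)..(L / 2), S ≤ ∫ x in (L / 4)..(L / 2), σ x :=
      intervalIntegral.integral_mono_on (by linarith) intervalIntegrable_const (hσi _ _)
        fun x hx => h3.trans (hσm.monotone hx.1)
    have h6 : h (L / 2) = h (L / 4) + ∫ x in (L / 4)..(L / 2), σ x :=
      (intervalIntegral.integral_add_adjacent_intervals (hσi _ _) (hσi _ _)).symm
    have h7 : 0 ≤ h (L / 4) := by
      rw [← hh0]; exact hhm (mem_Ici.2 le_rfl) (by simp; positivity) (by positivity)
    rw [intervalIntegral.integral_const, smul_eq_mul] at h5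
    have h8 : (L / 2 - L / 4) * S = 4 := by rw [hS]; field_simp; ring
    linarith

namespace IsProfile
variable {p η B : ℝ} {h σ : ℝ → ℝ}

theorem continuous_deriv (H : IsProfile p η B h σ) : Continuous σ :=
  continuous_iff_continuousAt.2 fun t => (H.hasDerivAt_deriv t).continuousAt

theorem continuous (H : IsProfile p η B h σ) : Continuous h :=
  continuous_iff_continuousAt.2 fun t => (H.hasDerivAt t).continuousAt

theorem weight_pos (hη : 0 < η) (s : ℝ) : 0 < |s| ^ (p - 2) + η := by
  have := Real.rpow_nonneg (abs_nonneg s) (p - 2); linarith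

theorem continuous_weight (hp : 2 ≤ p) : Continuous fun s : ℝ => |s| ^ (p - 2) + η :=
  (continuous_abs.rpow_const (fun _ => Or.inr (by linarith))).add continuous_const

theorem continuous_deriv2 (H : IsProfile p η B h σ) (hp : 2 ≤ p) (hη : 0 < η) :
    Continuous fun t => B / (|σ t| ^ (p - 2) + η) :=
  continuous_const.div ((continuous_weight hp).comp H.continuous_deriv)
    fun t => (weight_pos hη (σ t)).ne'

theorem contDiff (H : IsProfile p η B h σ) (hp : 2 ≤ p) (hη : 0 < η) : ContDiff ℝ 2 h := by
  have e1 : deriv h = σ := funext fun t => (H.hasDerivAt t).deriv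
  have e2 : deriv σ = fun t => B / (|σ t| ^ (p - 2) + η) :=
    funext fun t => (H.hasDerivAt_deriv t).deriv
  rw [show (2 : WithTop ℕ∞) = 1 + 1 by norm_num, contDiff_succ_iff_deriv]
  refine ⟨fun t => (H.hasDerivAt t).differentiableAt, by simp, ?_⟩
  rw [e1, contDiff_one_iff_deriv, e2]
  exact ⟨fun t => (H.hasDerivAt_deriv t).differentiableAt, H.continuous_deriv2 hp hη⟩

theorem le_mul_abs (H : IsProfile p η B h σ) {t : ℝ} (ht : |t| ≤ 2) :
    h t ≤ (2 * B + 1) * |t| := by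
  have := (convex_Icc (-2 : ℝ) 2).norm_image_sub_le_of_norm_hasDerivWithin_le
    (f := h) (f' := σ) (C := 2 * B + 1) (x := 0) (y := t)
    (fun x _ => (H.hasDerivAt x).hasDerivWithinAt)
    (fun x hx => by rw [Real.norm_eq_abs]; exact H.abs_deriv_le x (abs_le.2 hx))
    (by norm_num) (abs_le.1 ht)
  rw [H.zero, sub_zero, sub_zero, Real.norm_eq_abs, Real.norm_eq_abs] at this
  exact (le_abs_self _).trans this

/-- Taylor's inequality: the second derivative of a profile is at most `B / η`. -/
theorem le_quadratic (H : IsProfile p η B h σ) (hη : 0 < η) (hB : 0 < B) (t s : ℝ) :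
    h s ≤ h t + σ t * (s - t) + B / (2 * η) * (s - t) ^ 2 := by
  have key : ∀ x, |σ x - σ t| ≤ B / η * |x - t| := by
    intro x
    have := convex_univ.norm_image_sub_le_of_norm_hasDerivWithin_le
      (f := σ) (f' := fun x => B / (|σ x| ^ (p - 2) + η)) (C := B / η) (x := t) (y := x)
      (fun x _ => (H.hasDerivAt_deriv x).hasDerivWithinAt)
      (fun x _ => by
        have h1 := Real.rpow_nonneg (abs_nonneg (σ x)) (p - 2)
        rw [Real.norm_eq_abs, abs_of_nonneg (div_nonneg hB.le (by linarith))]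
        gcongr; linarith)
      (mem_univ _) (mem_univ _)
    simpa using this
  set k : ℝ → ℝ := fun x => h t + σ t * (x - t) + B / (2 * η) * (x - t) ^ 2 - h x with hk
  have hk' (x : ℝ) : HasDerivAt k (σ t + B / η * (x - t) - σ x) x := by
    have h1 : HasDerivAt (fun x : ℝ => x - t) 1 x := (hasDerivAt_id x).sub_const t
    have h2 := (((h1.const_mul (σ t)).const_add (h t)).add
      ((h1.pow 2).const_mul (B / (2 * η)))).sub (H.hasDerivAt x)
    refine HasDerivAt.congr_deriv h2 ?_
    push_cast
    field_simp
  have hkt : k t = 0 := by simp [hk]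
  have hkc : Continuous k := continuous_iff_continuousAt.2 fun x => (hk' x).continuousAt
  have hgoal : 0 ≤ k s := by
    rcases le_total t s with hts | hts
    · have hm : MonotoneOn k (Ici t) := by
        refine monotoneOn_of_deriv_nonneg (convex_Ici t) hkc.continuousOn
          (fun x _ => (hk' x).differentiableAt.differentiableWithinAt) ?_
        intro x hx
        rw [interior_Ici] at hx
        rw [(hk' x).deriv]
        have := key x
        rw [abs_of_pos (sub_pos.2 (mem_Ioi.1 hx) : 0 < x - t)] at this
        linarith [le_abs_self (σ x - σ t)]
      rw [← hkt]; exact hm (mem_Ici.2 le_rfl) hts hts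
    · have hm : AntitoneOn k (Iic t) := by
        refine antitoneOn_of_deriv_nonpos (convex_Iic t) hkc.continuousOn
          (fun x _ => (hk' x).differentiableAt.differentiableWithinAt) ?_
        intro x hx
        rw [interior_Iic] at hx
        rw [(hk' x).deriv]
        have := key x
        rw [abs_of_neg (sub_neg.2 (mem_Iio.1 hx) : x - t < 0)] at this
        linarith [neg_abs_le (σ x - σ t)]
      rw [← hkt]; exact hm hts (mem_Iic.2 le_rfl) hts
  simp only [hk] at hgoal
  linarith

/-- On `[-2, 2]` the inverse of `σ` is Lipschitz, uniformly in `η`: there the slope bound gives a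
lower bound on the second derivative. -/
theorem abs_sub_le (H : IsProfile p η B h σ) (hp : 2 ≤ p) (hη : 0 < η) (hη1 : η ≤ 1) (hB : 0 < B)
    {t s : ℝ} (ht : |t| ≤ 2) (hs : |s| ≤ 2) :
    |t - s| ≤ ((2 * B + 1) ^ (p - 2) + 1) / B * |σ t - σ s| := by
  wlog hst : s < t generalizing s t
  · rcases (not_lt.1 hst).eq_or_lt with h1 | h1
    · simp [h1]
    · rw [abs_sub_comm, abs_sub_comm (σ t)]; exact this hs ht h1
  obtain ⟨c, hc, hc'⟩ := exists_hasDerivAt_eq_slope σ (fun t => B / (|σ t| ^ (p - 2) + η)) hst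
    H.continuous_deriv.continuousOn fun x _ => H.hasDerivAt_deriv x
  have hcb : |c| ≤ 2 :=
    abs_le.2 ⟨by linarith [(abs_le.1 hs).1, hc.1], by linarith [(abs_le.1 ht).2, hc.2]⟩
  have hw : |σ c| ^ (p - 2) + η ≤ (2 * B + 1) ^ (p - 2) + 1 := by
    have := Real.rpow_le_rpow (abs_nonneg _) (H.abs_deriv_le c hcb) (by linarith : 0 ≤ p - 2)
    linarith
  have hw0 := weight_pos (p := p) hη (σ c)
  have hts : 0 < t - s := sub_pos.2 hst
  have e1 : σ t - σ s = B / (|σ c| ^ (p - 2) + η) * (t - s) := by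
    rw [hc']; field_simp
  rw [e1, abs_mul, abs_of_pos hts, abs_of_pos (div_pos hB hw0), ← mul_assoc]
  refine le_mul_of_one_le_left hts.le ?_
  rw [div_mul_div_comm, mul_comm B, mul_div_mul_right _ _ hB.ne', one_le_div hw0]
  exact hw

end IsProfile

/-! ### The Pucci operator and explicit test functions -/

/-- For a symmetric matrix bounded below by `-T`, the Pucci operator controls the trace. -/
theorem pucciMinus_ge {n : ℕ} {lam Lam T : ℝ} (hLam : lam ≤ Lam)
    (hT : 0 ≤ T) {A : Matrix (Fin n) (Fin n) ℝ} (hA : A.IsHermitian)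
    (hlow : ∀ ζ : Fin n → ℝ, -T * ∑ i, ζ i ^ 2 ≤ ζ ⬝ᵥ A.mulVec ζ) :
    lam * A.trace - (Lam - lam) * (n * T) ≤ pucciMinus lam Lam A := by
  classical
  have hev (i : Fin n) : -T ≤ hA.eigenvalues i := by
    have h1 := hlow (hA.eigenvectorBasis i)
    have h2 : ∑ j, (hA.eigenvectorBasis i) j ^ 2 = 1 := by
      rw [← EuclideanSpace.real_norm_sq_eq, hA.eigenvectorBasis.orthonormal.1 i, one_pow]
    rw [h2, mul_one] at h1
    rw [hA.eigenvalues_eq]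
    simpa using h1
  have htr : A.trace = ∑ i, hA.eigenvalues i := by
    simpa using hA.trace_eq_sum_eigenvalues
  rw [pucciMinus, dif_pos hA, htr, Finset.sum_filter, Finset.sum_filter, Finset.mul_sum,
    Finset.mul_sum, Finset.mul_sum, ← Finset.sum_add_distrib]
  have : (Lam - lam) * (n * T) = ∑ _i : Fin n, (Lam - lam) * T := by simp; ring
  rw [this, ← Finset.sum_sub_distrib]
  refine Finset.sum_le_sum fun i _ => ?_
  have h3 := hev i
  have h4 : 0 ≤ (Lam - lam) * T := mul_nonneg (by linarith) hT
  rcases lt_trichotomy (hA.eigenvalues i) 0 with h | h | h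
  · simp only [h, h.not_gt, if_true, if_false, mul_zero, add_zero]
    nlinarith
  · simp only [h, lt_irrefl, if_false]; linarith
  · simp only [h, h.not_gt, if_true, if_false, mul_zero, zero_add]; linarith

theorem weightedHessian_apply {n : ℕ} (p : Fin n → ℝ) (ψ : EuclideanSpace ℝ (Fin n) → ℝ)
    (x : EuclideanSpace ℝ (Fin n)) (i j : Fin n) :
    weightedHessian p ψ x i j = |partialDeriv ψ x i| ^ ((p i - 2) / 2) * hessianMatrix ψ x i j *
      |partialDeriv ψ x j| ^ ((p j - 2) / 2) := by
  simp [weightedHessian, Matrix.mul_diagonal, Matrix.diagonal_mul]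

theorem rpow_half_mul_self {t q : ℝ} (ht : 0 ≤ t) :
    t ^ (q / 2) * t ^ (q / 2) = t ^ q := by
  rw [← sq, ← Real.rpow_natCast, ← Real.rpow_mul ht]; norm_num

theorem trace_weightedHessian {n : ℕ} (p : Fin n → ℝ) (ψ : EuclideanSpace ℝ (Fin n) → ℝ)
    (x : EuclideanSpace ℝ (Fin n)) :
    (weightedHessian p ψ x).trace =
      ∑ i, |partialDeriv ψ x i| ^ (p i - 2) * hessianMatrix ψ x i i := by
  refine Finset.sum_congr rfl fun i _ => ?_
  rw [Matrix.diag_apply, weightedHessian_apply, mul_right_comm,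
    rpow_half_mul_self (abs_nonneg _)]

theorem dotProduct_weightedHessian {n : ℕ} (p : Fin n → ℝ) (ψ : EuclideanSpace ℝ (Fin n) → ℝ)
    (x : EuclideanSpace ℝ (Fin n)) (ζ : Fin n → ℝ) :
    ζ ⬝ᵥ (weightedHessian p ψ x).mulVec ζ =
      ∑ i, ∑ j, (|partialDeriv ψ x i| ^ ((p i - 2) / 2) * ζ i) *
        hessianMatrix ψ x i j * (|partialDeriv ψ x j| ^ ((p j - 2) / 2) * ζ j) := by
  simp only [dotProduct, Matrix.mulVec, weightedHessian_apply, Finset.mul_sum]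
  refine Finset.sum_congr rfl fun i _ => Finset.sum_congr rfl fun j _ => ?_
  ring

theorem partialDeriv_comp_add_const {n : ℕ} (ψ : EuclideanSpace ℝ (Fin n) → ℝ)
    (a x : EuclideanSpace ℝ (Fin n)) (i : Fin n) :
    partialDeriv (fun y => ψ (y + a)) x i = partialDeriv ψ (x + a) i := by
  rw [partialDeriv, fderiv_comp_add_right]; rfl

theorem hessianMatrix_comp_add_const {n : ℕ} (ψ : EuclideanSpace ℝ (Fin n) → ℝ)
    (a x : EuclideanSpace ℝ (Fin n)) :
    hessianMatrix (fun y => ψ (y + a)) x = hessianMatrix ψ (x + a) := by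
  have : fderiv ℝ (fun y => ψ (y + a)) = fun y => fderiv ℝ ψ (y + a) :=
    funext fun y => fderiv_comp_add_right a
  ext i j
  simp only [hessianMatrix, Matrix.of_apply, this]
  rw [fderiv_comp_add_right]

theorem weightedHessian_comp_add_const {n : ℕ} (p : Fin n → ℝ)
    (ψ : EuclideanSpace ℝ (Fin n) → ℝ) (a x : EuclideanSpace ℝ (Fin n)) :
    weightedHessian p (fun y => ψ (y + a)) x = weightedHessian p ψ (x + a) := by
  simp only [weightedHessian, hessianMatrix_comp_add_const, partialDeriv_comp_add_const]

theorem deriv_deriv_nonpos_of_isLocalMax {f : ℝ → ℝ} {x₀ : ℝ} (h : IsLocalMax f x₀)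
    (hf : ContinuousAt f x₀) : deriv (deriv f) x₀ ≤ 0 := by
  by_contra! hc
  have hmin := isLocalMin_of_deriv_deriv_pos hc h.deriv_eq_zero hf
  have hconst : f =ᶠ[𝓝 x₀] fun _ => f x₀ := by
    filter_upwards [h, hmin] with y h1 h2 using le_antisymm h1 h2
  have h1 : deriv f =ᶠ[𝓝 x₀] fun _ => 0 := by simpa using hconst.deriv
  have h2 := h1.deriv_eq
  simp at h2
  linarith

/-- If the graph of `ψ` lies locally below a paraboloid of opening `κ` and touches it at `x₀`, then
the gradients agree at `x₀` and the pure second derivatives of `ψ` are at most `κ`. -/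
theorem touching_paraboloid {n : ℕ} {ψ : EuclideanSpace ℝ (Fin n) → ℝ}
    (hψ : ContDiff ℝ 2 ψ) {x₀ c : EuclideanSpace ℝ (Fin n)} {κ : ℝ}
    (h : ∀ᶠ x in 𝓝 x₀, ψ x ≤ ψ x₀ + inner ℝ c (x - x₀) + κ / 2 * ‖x - x₀‖ ^ 2) (i : Fin n) :
    partialDeriv ψ x₀ i = c i ∧ hessianMatrix ψ x₀ i i ≤ κ := by
  set e : EuclideanSpace ℝ (Fin n) := EuclideanSpace.single i 1 with he
  have hline (t : ℝ) : HasDerivAt (fun t : ℝ => x₀ + t • e) e t := by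
    simpa using ((hasDerivAt_id t).smul_const e).const_add x₀
  have hd1 (t : ℝ) : HasDerivAt (fun t : ℝ => ψ (x₀ + t • e)) (fderiv ℝ ψ (x₀ + t • e) e) t :=
    ((hψ.differentiable (by simp) _).hasFDerivAt).comp_hasDerivAt t (hline t)
  have hd2 : HasDerivAt (fun t : ℝ => fderiv ℝ ψ (x₀ + t • e) e) (hessianMatrix ψ x₀ i i) 0 := by
    have h1 : ContDiff ℝ 1 (fderiv ℝ ψ) := hψ.fderiv_right (by norm_num)
    have h2 : HasFDerivAt (fderiv ℝ ψ) (fderiv ℝ (fderiv ℝ ψ) x₀) (x₀ + (0 : ℝ) • e) := by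
      have := (h1.differentiable (by simp) x₀).hasFDerivAt
      simpa using this
    have h3 := h2.comp_hasDerivAt (0 : ℝ) (hline 0)
    have h4 := h3.clm_apply (hasDerivAt_const (0 : ℝ) e)
    simpa [hessianMatrix] using h4
  set f : ℝ → ℝ := fun t => ψ (x₀ + t • e) - (c i * t + κ / 2 * t ^ 2) with hf
  have hf1 (t : ℝ) : HasDerivAt f (fderiv ℝ ψ (x₀ + t • e) e - (c i + κ * t)) t := by
    have h2 := ((hasDerivAt_id t).const_mul (c i)).add (((hasDerivAt_id t).pow 2).const_mul (κ / 2))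
    refine ((hd1 t).sub h2).congr_deriv ?_
    simp; ring
  have hf2 : HasDerivAt (deriv f) (hessianMatrix ψ x₀ i i - κ) 0 := by
    have : deriv f = fun t => fderiv ℝ ψ (x₀ + t • e) e - (c i + κ * t) :=
      funext fun t => (hf1 t).deriv
    rw [this]
    have h2 := (((hasDerivAt_id (0 : ℝ)).const_mul κ).const_add (c i))
    refine (hd2.sub h2).congr_deriv ?_
    simp
  have hmax : IsLocalMax f 0 := by
    have ht : Tendsto (fun t : ℝ => x₀ + t • e) (𝓝 0) (𝓝 x₀) := by
      have := (hline 0).continuousAt.tendsto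
      simpa using this
    filter_upwards [ht.eventually h] with t ht
    have h3 : ‖e‖ = 1 := by simp [he]
    have h4 : inner ℝ c e = c i := by simp [he, EuclideanSpace.inner_single_right]
    rw [add_sub_cancel_left, inner_smul_right, norm_smul, h3, h4, mul_one, Real.norm_eq_abs,
      sq_abs] at ht
    simp only [hf, zero_smul, add_zero]
    linarith
  refine ⟨?_, ?_⟩
  · have := hmax.hasDerivAt_eq_zero (hf1 0)
    simp only [zero_smul, add_zero, mul_zero] at this
    rw [partialDeriv]; linarith
  · have := deriv_deriv_nonpos_of_isLocalMax hmax (hf1 0).continuousAt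
    rw [hf2.deriv] at this; linarith

section separable
variable {n : ℕ} {f f' f'' : Fin n → ℝ → ℝ} {b : Fin n → ℝ} {c a d : ℝ}

/-- The function `c + ∑ i, f i (x i) + a (b ⬝ x + d) ^ 2`: a separable function plus a multiple of
the square of an affine function. Every test function below has this form. -/
noncomputable def separableAddSq (f : Fin n → ℝ → ℝ) (b : Fin n → ℝ) (a d c : ℝ)
    (x : EuclideanSpace ℝ (Fin n)) : ℝ :=
  c + ∑ i, f i (x i) + a * (∑ i, b i * x i + d) ^ 2

theorem hasFDerivAt_coord (x : EuclideanSpace ℝ (Fin n)) (i : Fin n) :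
    HasFDerivAt (fun x : EuclideanSpace ℝ (Fin n) => x i)
      (EuclideanSpace.proj i : EuclideanSpace ℝ (Fin n) →L[ℝ] ℝ) x :=
  (EuclideanSpace.proj i : EuclideanSpace ℝ (Fin n) →L[ℝ] ℝ).hasFDerivAt

theorem hasFDerivAt_separableAddSq (hf : ∀ i t, HasDerivAt (f i) (f' i t) t)
    (x : EuclideanSpace ℝ (Fin n)) :
    HasFDerivAt (separableAddSq f b a d c)
      (∑ i, (f' i (x i) + 2 * a * (∑ j, b j * x j + d) * b i) •
        (EuclideanSpace.proj i : EuclideanSpace ℝ (Fin n) →L[ℝ] ℝ)) x := by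
  have h1 : HasFDerivAt (fun x : EuclideanSpace ℝ (Fin n) => ∑ i, f i (x i))
      (∑ i, f' i (x i) • (EuclideanSpace.proj i : EuclideanSpace ℝ (Fin n) →L[ℝ] ℝ)) x :=
    HasFDerivAt.fun_sum fun i _ => (hf i (x i)).comp_hasFDerivAt x (hasFDerivAt_coord x i)
  have h2 : HasFDerivAt (fun x : EuclideanSpace ℝ (Fin n) => ∑ i, b i * x i + d)
      (∑ i, b i • (EuclideanSpace.proj i : EuclideanSpace ℝ (Fin n) →L[ℝ] ℝ)) x :=
    (HasFDerivAt.fun_sum fun i _ => (hasFDerivAt_coord x i).const_mul (b i)).add_const d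
  have h3 := (h1.const_add c).add ((h2.pow 2).const_mul a)
  refine h3.congr_fderiv ?_
  ext v
  simp
  simp only [add_mul _ _ (v _), Finset.sum_add_distrib, mul_assoc, ← Finset.mul_sum]
  ring

theorem partialDeriv_separableAddSq (hf : ∀ i t, HasDerivAt (f i) (f' i t) t)
    (x : EuclideanSpace ℝ (Fin n)) (i : Fin n) :
    partialDeriv (separableAddSq f b a d c) x i =
      f' i (x i) + 2 * a * (∑ j, b j * x j + d) * b i := by
  rw [partialDeriv, (hasFDerivAt_separableAddSq hf x).fderiv]
  simp

theorem hessianMatrix_separableAddSq (hf : ∀ i t, HasDerivAt (f i) (f' i t) t)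
    (hf' : ∀ i t, HasDerivAt (f' i) (f'' i t) t)
    (x : EuclideanSpace ℝ (Fin n)) (i j : Fin n) :
    hessianMatrix (separableAddSq f b a d c) x i j =
      (if i = j then f'' i (x i) else 0) + 2 * a * b i * b j := by
  have e1 : fderiv ℝ (separableAddSq f b a d c) = fun x =>
      (∑ i, (f' i (x i) + 2 * a * (∑ j, b j * x j + d) * b i) •
        (EuclideanSpace.proj i : EuclideanSpace ℝ (Fin n) →L[ℝ] ℝ)) :=
    funext fun x => (hasFDerivAt_separableAddSq hf x).fderiv
  have h2 : HasFDerivAt (fun x : EuclideanSpace ℝ (Fin n) => ∑ i, b i * x i + d)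
      (∑ i, b i • (EuclideanSpace.proj i : EuclideanSpace ℝ (Fin n) →L[ℝ] ℝ)) x :=
    (HasFDerivAt.fun_sum fun i _ => (hasFDerivAt_coord x i).const_mul (b i)).add_const d
  have h3 (k : Fin n) := ((hf' k (x k)).comp_hasFDerivAt x (hasFDerivAt_coord x k)).add
    ((h2.const_mul (2 * a)).mul_const (b k))
  have h4 := HasFDerivAt.fun_sum (u := Finset.univ) fun k _ => (h3 k).smul_const
    (EuclideanSpace.proj k : EuclideanSpace ℝ (Fin n) →L[ℝ] ℝ)
  have h5 : HasFDerivAt (fun x => (∑ i, (f' i (x i) + 2 * a * (∑ j, b j * x j + d) * b i) •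
        (EuclideanSpace.proj i : EuclideanSpace ℝ (Fin n) →L[ℝ] ℝ))) _ x := h4
  rw [hessianMatrix, Matrix.of_apply, e1, h5.fderiv]
  simp [eq_comm]
  split_ifs with hij
  · subst hij; ring
  · ring

theorem contDiff_separableAddSq (hf : ∀ i, ContDiff ℝ 2 (f i)) :
    ContDiff ℝ 2 (separableAddSq f b a d c) := by
  have hc (i : Fin n) : ContDiff ℝ 2 (fun x : EuclideanSpace ℝ (Fin n) => x i) :=
    (EuclideanSpace.proj i : EuclideanSpace ℝ (Fin n) →L[ℝ] ℝ).contDiff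
  unfold separableAddSq
  have h1 : ContDiff ℝ 2 (fun x : EuclideanSpace ℝ (Fin n) => ∑ i, f i (x i)) :=
    ContDiff.sum fun i _ => (hf i).comp (hc i)
  have h2 : ContDiff ℝ 2 (fun x : EuclideanSpace ℝ (Fin n) => ∑ i, b i * x i + d) :=
    (ContDiff.sum fun i _ => contDiff_const.mul (hc i)).add contDiff_const
  exact (contDiff_const.add h1).add (contDiff_const.mul (h2.pow 2))

end separable

/-! ### Inf-convolution and the trace bound -/

/-- The closed box with half-widths `L i`. -/
def centeredBox {n : ℕ} (L : Fin n → ℝ) : Set (EuclideanSpace ℝ (Fin n)) := {x | ∀ i, |x i| ≤ L i}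

section box
variable {n : ℕ} {L : Fin n → ℝ}

theorem abs_coord_le_norm (x : EuclideanSpace ℝ (Fin n)) (i : Fin n) : |x i| ≤ ‖x‖ := by
  simpa using PiLp.norm_apply_le x i

theorem continuous_coord (i : Fin n) : Continuous fun x : EuclideanSpace ℝ (Fin n) => x i :=
  (EuclideanSpace.proj i : EuclideanSpace ℝ (Fin n) →L[ℝ] ℝ).continuous

theorem isCompact_centeredBox (L : Fin n → ℝ) : IsCompact (centeredBox L) := by
  have h1 : IsCompact (Set.pi univ fun i => Icc (-L i) (L i)) :=
    isCompact_univ_pi fun i => isCompact_Icc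
  have h2 := (EuclideanSpace.equiv (Fin n) ℝ).symm.toHomeomorph.isCompact_image.2 h1
  convert h2 using 1
  ext x
  constructor
  · intro hx
    exact ⟨fun i => x i, fun i _ => abs_le.1 (hx i), rfl⟩
  · rintro ⟨y, hy, rfl⟩ i
    exact abs_le.2 (hy i (mem_univ i))

theorem mem_interior_centeredBox {x : EuclideanSpace ℝ (Fin n)} (hx : ∀ i, |x i| < L i) :
    x ∈ interior (centeredBox L) := by
  rw [mem_interior]
  refine ⟨{x | ∀ i, |x i| < L i}, fun y hy i => (hy i).le, ?_, hx⟩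
  rw [ofPred_forall]
  exact isOpen_iInter_of_finite fun i => isOpen_lt (continuous_coord i).abs continuous_const

end box

/-- The inf-convolution `x ↦ min_{z ∈ K} (u z + ‖x - z‖ ^ 2 / (2 η))` of `u` over `K`, defined on the
whole space. The minimum is written as an `sInf`; it is attained for compact `K ≠ ∅` and `u`
continuous on `K`, see `exists_infConv_eq`. -/
noncomputable def infConv {n : ℕ} (K : Set (EuclideanSpace ℝ (Fin n)))
    (u : EuclideanSpace ℝ (Fin n) → ℝ) (η : ℝ) (x : EuclideanSpace ℝ (Fin n)) : ℝ :=
  sInf ((fun z => u z + ‖x - z‖ ^ 2 / (2 * η)) '' K)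

section infConv
variable {n : ℕ} {K : Set (EuclideanSpace ℝ (Fin n))} {u : EuclideanSpace ℝ (Fin n) → ℝ} {η : ℝ}

theorem exists_infConv_eq (hK : IsCompact K) (hK0 : K.Nonempty) (hu : ContinuousOn u K)
    (x : EuclideanSpace ℝ (Fin n)) :
    ∃ z ∈ K, infConv K u η x = u z + ‖x - z‖ ^ 2 / (2 * η) := by
  have hc : ContinuousOn (fun z => u z + ‖x - z‖ ^ 2 / (2 * η)) K := by fun_prop
  obtain ⟨z, hz, h⟩ := (hK.image_of_continuousOn hc).sInf_mem (hK0.image _)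
  exact ⟨z, hz, h.symm⟩

theorem infConv_le (hK : IsCompact K) (hu : ContinuousOn u K)
    (x : EuclideanSpace ℝ (Fin n)) {z : EuclideanSpace ℝ (Fin n)} (hz : z ∈ K) :
    infConv K u η x ≤ u z + ‖x - z‖ ^ 2 / (2 * η) := by
  have hc : ContinuousOn (fun z => u z + ‖x - z‖ ^ 2 / (2 * η)) K := by fun_prop
  exact csInf_le (hK.image_of_continuousOn hc).bddBelow ⟨z, hz, rfl⟩

theorem infConv_le_self (hK : IsCompact K) (hu : ContinuousOn u K)
    {x : EuclideanSpace ℝ (Fin n)} (hx : x ∈ K) : infConv K u η x ≤ u x := by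
  simpa using infConv_le (η := η) hK hu x hx

theorem infConv_nonneg (hη : 0 < η) (hu : ∀ x ∈ K, 0 ≤ u x) (x : EuclideanSpace ℝ (Fin n)) :
    0 ≤ infConv K u η x := by
  refine Real.sInf_nonneg ?_
  rintro _ ⟨z, hz, rfl⟩
  have := hu z hz
  positivity

theorem continuous_infConv (hK : IsCompact K) (hu : ContinuousOn u K) :
    Continuous (infConv K u η) := by
  have : CompactSpace K := isCompact_iff_compactSpace.1 hK
  have h1 : Continuous fun q : EuclideanSpace ℝ (Fin n) × K =>
      u q.2 + ‖q.1 - q.2‖ ^ 2 / (2 * η) := by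
    have := (continuousOn_iff_continuous_domRestrict.1 hu).comp
      (continuous_snd (X := EuclideanSpace ℝ (Fin n)))
    refine Continuous.add this ?_
    fun_prop
  have h2 : Continuous fun x : EuclideanSpace ℝ (Fin n) =>
      sInf ((fun z : K => u z + ‖x - z‖ ^ 2 / (2 * η)) '' univ) :=
    isCompact_univ.continuous_sInf h1
  convert h2 using 2 with x
  rw [infConv]
  congr 1
  ext y
  simp

theorem norm_sub_sq_expand (x x₀ z : EuclideanSpace ℝ (Fin n)) :
    ‖x - z‖ ^ 2 = ‖x₀ - z‖ ^ 2 + 2 * inner ℝ (x₀ - z) (x - x₀) + ‖x - x₀‖ ^ 2 := by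
  rw [← norm_add_sq_real]; congr 2; abel

theorem infConv_le_paraboloid (hK : IsCompact K) (hu : ContinuousOn u K)
    (hη : 0 < η) {x₀ z : EuclideanSpace ℝ (Fin n)} (hz : z ∈ K)
    (hx₀ : infConv K u η x₀ = u z + ‖x₀ - z‖ ^ 2 / (2 * η)) (x : EuclideanSpace ℝ (Fin n)) :
    infConv K u η x ≤ infConv K u η x₀ + inner ℝ (η⁻¹ • (x₀ - z)) (x - x₀)
      + η⁻¹ / 2 * ‖x - x₀‖ ^ 2 := by
  refine (infConv_le hK hu x hz).trans (le_of_eq ?_)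
  rw [hx₀, norm_sub_sq_expand x x₀ z, real_inner_smul_left]
  field_simp
  ring

/-- The inf-convolution satisfies the same inequality at `x₀`, provided that its minimum is attained
at an interior point `z`: a test function touching it at `x₀`, translated by `z - x₀`, touches `u` at
`z`, and the operator does not depend on the point. -/
theorem infConv_supersolution {p : Fin n → ℝ} {lam Lam ε : ℝ} (hK : IsCompact K)
    (hu : ContinuousOn u K)
    (hv : IsViscositySupersolution p lam Lam Lam ε (interior K) u)
    {x₀ z : EuclideanSpace ℝ (Fin n)} (hz : z ∈ interior K)
    (hx₀ : infConv K u η x₀ = u z + ‖x₀ - z‖ ^ 2 / (2 * η))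
    {ψ : EuclideanSpace ℝ (Fin n) → ℝ} (hψ : ContDiff ℝ 2 ψ)
    (hmin : IsLocalMin (fun x => infConv K u η x - ψ x) x₀) :
    pucciMinus lam Lam (weightedHessian p ψ x₀)
      - Lam * ∑ i, |partialDeriv ψ x₀ i| ^ (p i - 1) ≤ ε := by
  have h1 := hv.2 z hz (fun y => ψ (y + (x₀ - z)))
    (hψ.comp (contDiff_id.add contDiff_const)).contDiffOn ?_
  · simpa [weightedHessian_comp_add_const, partialDeriv_comp_add_const] using h1
  · have ht : Tendsto (fun y => y + (x₀ - z)) (𝓝 z) (𝓝 x₀) := by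
      have : Continuous fun y : EuclideanSpace ℝ (Fin n) => y + (x₀ - z) := by fun_prop
      simpa using this.tendsto z
    refine IsMinFilter.filter_mono ?_ nhdsWithin_le_nhds
    filter_upwards [ht.eventually hmin, mem_interior_iff_mem_nhds.1 hz] with y hy hyK
    have h2 := infConv_le (η := η) hK hu (y + (x₀ - z)) hyK
    have h3 : y + (x₀ - z) - y = x₀ - z := by abel
    rw [h3] at h2
    have h4 : z + (x₀ - z) = x₀ := by abel
    rw [h4]
    linarith

end infConv

/-- The only consequence of the equation used for contact sets: for a test function `ψ` touching `v`
from below at a point of `Ω` where `v ≤ 2`, with slopes at most `S` and weighted Hessian at least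
`-T`, the trace of `D²ψ` against the nondegenerate weights `|D_i ψ| ^ (p_i - 2) + η` is at
most `C`. -/
def HasTraceBound {n : ℕ} (p : Fin n → ℝ) (η T S C : ℝ) (Ω : Set (EuclideanSpace ℝ (Fin n)))
    (v : EuclideanSpace ℝ (Fin n) → ℝ) : Prop :=
  ∀ x ∈ Ω, v x ≤ 2 → ∀ ψ : EuclideanSpace ℝ (Fin n) → ℝ, ContDiff ℝ 2 ψ →
    IsLocalMin (fun x => v x - ψ x) x → (∀ i, |partialDeriv ψ x i| ≤ S) →
    (∀ ζ : Fin n → ℝ, -T * ∑ i, ζ i ^ 2 ≤ ζ ⬝ᵥ (weightedHessian p ψ x).mulVec ζ) →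
    ∑ i, (|partialDeriv ψ x i| ^ (p i - 2) + η) * hessianMatrix ψ x i i ≤ C

/-- The inf-convolution at scale `η` of a supersolution has the trace bound, with a constant that does
not depend on `η`. The weight `η` comes for free: the inf-convolution lies below paraboloids of
opening `1 / η`, so `η D_ii ψ ≤ 1`, also in directions in which the equation degenerates. -/
theorem hasTraceBound_infConv {n : ℕ} {p L : Fin n → ℝ} (hp : ∀ i, 2 ≤ p i) {lam Lam ε T S η : ℝ}
    (hlam : 0 < lam) (hLam : lam ≤ Lam) (hT : 0 ≤ T) (hη : 0 < η) (hL : ∀ i, 0 < L i)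
    (hηL : ∀ i, 4 * η ≤ (L i / 16) ^ 2)
    {u : EuclideanSpace ℝ (Fin n) → ℝ} (hu : ContinuousOn u (centeredBox L))
    (hu0 : ∀ x ∈ centeredBox L, 0 ≤ u x)
    (hv : IsViscositySupersolution p lam Lam Lam ε (interior (centeredBox L)) u) :
    HasTraceBound p η T S
      ((ε + Lam * ∑ i, S ^ (p i - 1) + (Lam - lam) * (n * T)) / lam + n)
      {x | ∀ i, |x i| ≤ 7 / 8 * L i} (infConv (centeredBox L) u η) := by
  intro x hx hvx ψ hψ hmin hS hlow
  have hK := isCompact_centeredBox L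
  obtain ⟨z, hz, hzx⟩ := exists_infConv_eq (η := η) hK
    ⟨0, fun i => by simpa using (hL i).le⟩ hu x
  have hzint : z ∈ interior (centeredBox L) := by
    refine mem_interior_centeredBox fun i => ?_
    have h1 : ‖x - z‖ ^ 2 ≤ 4 * η := by
      have h2 : ‖x - z‖ ^ 2 / (2 * η) ≤ 2 := by linarith [hu0 z hz]
      rw [div_le_iff₀ (by positivity)] at h2
      linarith
    have h2 : ‖x - z‖ ≤ L i / 16 :=
      le_of_sq_le_sq (h1.trans (hηL i)) (by have := hL i; positivity)
    have h3 := (abs_coord_le_norm (x - z) i).trans h2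
    have h4 := hx i
    have h5 := hL i
    rw [PiLp.sub_apply] at h3
    rw [abs_le] at h3 h4
    rw [abs_lt]
    constructor <;> linarith
  have hpde := infConv_supersolution hK hu hv hzint hzx hψ hmin
  have hpar : ∀ᶠ y in 𝓝 x, ψ y ≤ ψ x + inner ℝ (η⁻¹ • (x - z)) (y - x)
      + η⁻¹ / 2 * ‖y - x‖ ^ 2 := by
    filter_upwards [hmin] with y hy
    have := infConv_le_paraboloid hK hu hη hz hzx y
    linarith
  have hdiag (i : Fin n) : η * hessianMatrix ψ x i i ≤ 1 := by
    have := (touching_paraboloid hψ hpar i).2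
    calc η * hessianMatrix ψ x i i ≤ η * η⁻¹ := by gcongr
      _ = 1 := mul_inv_cancel₀ hη.ne'
  have hpuc := pucciMinus_ge hLam hT (weightedHessian_isHermitian p hψ.contDiffAt) hlow
  rw [trace_weightedHessian] at hpuc
  have hLam0 : 0 ≤ Lam := hlam.le.trans hLam
  have hgrad : Lam * ∑ i, |partialDeriv ψ x i| ^ (p i - 1) ≤ Lam * ∑ i, S ^ (p i - 1) := by
    gcongr with i
    · linarith [hp i]
    · exact hS i
  simp only [add_mul, Finset.sum_add_distrib]
  refine add_le_add ?_ ?_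
  · rw [le_div_iff₀ hlam]; linarith
  · calc ∑ i, η * hessianMatrix ψ x i i ≤ ∑ _i : Fin n, (1 : ℝ) :=
        Finset.sum_le_sum fun i _ => hdiag i
      _ = n := by simp

/-! ### Contact points and the rescaling -/

section contact
variable {n : ℕ}

/-- The function `z ↦ v x + ∑ i, h i (x i - y i) - ∑ i, h i (z i - y i)`, centred at `y`, touches `v`
from below at `x`, globally. -/
def IsContactPair (h : Fin n → ℝ → ℝ) (v : EuclideanSpace ℝ (Fin n) → ℝ)
    (x y : EuclideanSpace ℝ (Fin n)) : Prop :=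
  ∀ z, v x + ∑ i, h i (x i - y i) ≤ v z + ∑ i, h i (z i - y i)

variable {p : Fin n → ℝ} {η B : ℝ} {h σ : Fin n → ℝ → ℝ} {v : EuclideanSpace ℝ (Fin n) → ℝ}
  {x₀ y₀ x₁ y₁ : EuclideanSpace ℝ (Fin n)}

/-- If `v` has a contact point at `x₀` and lies below a paraboloid that meets it there, then the
paraboloid and the touching function have the same gradient at `x₀`. -/
theorem IsContactPair.gradient_eq (hp : ∀ i, 2 ≤ p i) (hη : 0 < η)
    (H : ∀ i, IsProfile (p i) η B (h i) (σ i)) (hc : IsContactPair h v x₀ y₀)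
    {c : EuclideanSpace ℝ (Fin n)} {κ : ℝ}
    (hsc : ∀ x, v x ≤ v x₀ + inner ℝ c (x - x₀) + κ / 2 * ‖x - x₀‖ ^ 2) (i : Fin n) :
    c i = -σ i (x₀ i - y₀ i) := by
  set f : Fin n → ℝ → ℝ := fun i t => -h i (t - y₀ i) with hf
  have hf' (i : Fin n) (t : ℝ) : HasDerivAt (f i) (-σ i (t - y₀ i)) t :=
    (((H i).hasDerivAt (t - y₀ i)).comp_sub_const t (y₀ i)).neg
  have hC : ContDiff ℝ 2 (separableAddSq f (fun _ => 0) 0 0 0) :=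
    contDiff_separableAddSq fun i =>
      (((H i).contDiff (hp i) hη).comp (contDiff_id.sub contDiff_const)).neg
  have hval (x : EuclideanSpace ℝ (Fin n)) :
      separableAddSq f (fun _ => 0) 0 0 0 x = -∑ i, h i (x i - y₀ i) := by
    simp [separableAddSq, hf]
  have := (touching_paraboloid hC (x₀ := x₀) (c := c) (κ := κ) (Eventually.of_forall fun x => by
    rw [hval, hval]
    have h1 := hc x
    have h2 := hsc x
    linarith) i).1
  rw [partialDeriv_separableAddSq hf'] at this
  rw [← this]; simp

/-- The contact gradient is Lipschitz (with a constant that blows up as `η → 0`), because at each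
contact point `v` lies between two functions with second derivatives of order `1 / η`. -/
theorem IsContactPair.abs_deriv_sub_le (hp : ∀ i, 2 ≤ p i) (hη : 0 < η) (hB : 0 < B)
    (H : ∀ i, IsProfile (p i) η B (h i) (σ i))
    (hsc : ∀ x₀, ∃ c, ∀ x, v x ≤ v x₀ + inner ℝ c (x - x₀) + η⁻¹ / 2 * ‖x - x₀‖ ^ 2)
    (hc₀ : IsContactPair h v x₀ y₀) (hc₁ : IsContactPair h v x₁ y₁) (i : Fin n) :
    |σ i (x₁ i - y₁ i) - σ i (x₀ i - y₀ i)| ≤ (2 + B) / η * ‖x₁ - x₀‖ := by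
  obtain ⟨c, hc⟩ := hsc x₀
  have hci := fun i => hc₀.gradient_eq hp hη H hc i
  -- compare the upper paraboloid at `x₀` with the lower function at `x₁` in `x₁ + s eᵢ`
  have key : ∀ s : ℝ, s ≠ 0 → ‖x₁ - x₀‖ ≤ |s| →
      (σ i (x₀ i - y₀ i) - σ i (x₁ i - y₁ i)) * s ≤ (2 + B) / η * s ^ 2 := by
    intro s hs0 hs
    set x : EuclideanSpace ℝ (Fin n) := x₁ + EuclideanSpace.single i s with hx
    have hxi : x i = x₁ i + s := by simp [hx]
    have hxj (j : Fin n) (hj : j ≠ i) : x j = x₁ j := by simp [hx, hj]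
    have h1 := hc x
    have h2 : ∑ j, h j (x j - y₁ j) - ∑ j, h j (x₁ j - y₁ j)
        = h i (x₁ i + s - y₁ i) - h i (x₁ i - y₁ i) := by
      rw [← Finset.sum_sub_distrib, Finset.sum_eq_single i]
      · rw [hxi]
      · intro j _ hj; rw [hxj j hj, sub_self]
      · simp
    have h3 := hc₁ x
    have h4 := (H i).le_quadratic hη hB (x₁ i - y₁ i) (x₁ i + s - y₁ i)
    have h5 := hc₀ x₁
    have h6 : ∑ j, h j (x₁ j - y₀ j) ≤ ∑ j, h j (x₀ j - y₀ j) - inner ℝ c (x₁ - x₀)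
        + B / (2 * η) * ‖x₁ - x₀‖ ^ 2 := by
      have : inner ℝ c (x₁ - x₀) = ∑ j, -σ j (x₀ j - y₀ j) * (x₁ j - x₀ j) := by
        rw [PiLp.inner_apply]
        refine Finset.sum_congr rfl fun j _ => ?_
        rw [hci j]; simp [mul_comm]
      rw [this, EuclideanSpace.real_norm_sq_eq, Finset.mul_sum, ← Finset.sum_sub_distrib,
        ← Finset.sum_add_distrib]
      refine Finset.sum_le_sum fun j _ => ?_
      have h7 := (H j).le_quadratic hη hB (x₀ j - y₀ j) (x₁ j - y₀ j)
      have h8 : x₁ j - y₀ j - (x₀ j - y₀ j) = x₁ j - x₀ j := by ring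
      rw [h8] at h7
      rw [PiLp.sub_apply]
      linarith
    have h9 : inner ℝ c (x - x₀) = inner ℝ c (x₁ - x₀) - σ i (x₀ i - y₀ i) * s := by
      have : x - x₀ = (x₁ - x₀) + EuclideanSpace.single i s := by rw [hx]; abel
      rw [this, inner_add_right, EuclideanSpace.inner_single_right, hci i]
      simp; ring
    have h10 : ‖x - x₀‖ ^ 2 ≤ 4 * s ^ 2 := by
      have : x - x₀ = (x₁ - x₀) + EuclideanSpace.single i s := by rw [hx]; abel
      have h11 : ‖x - x₀‖ ≤ 2 * |s| := by
        rw [this]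
        refine (norm_add_le _ _).trans ?_
        rw [PiLp.norm_single, Real.norm_eq_abs]; linarith
      calc ‖x - x₀‖ ^ 2 ≤ (2 * |s|) ^ 2 := by gcongr
        _ = 4 * s ^ 2 := by rw [mul_pow, sq_abs]; ring
    have h11 : ‖x₁ - x₀‖ ^ 2 ≤ s ^ 2 := by
      rw [← sq_abs s]; gcongr
    have h12 : x₁ i + s - y₁ i - (x₁ i - y₁ i) = s := by ring
    rw [h12] at h4
    have h13 : η⁻¹ / 2 * ‖x - x₀‖ ^ 2 ≤ η⁻¹ / 2 * (4 * s ^ 2) := by gcongr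
    have h14 : B / (2 * η) * ‖x₁ - x₀‖ ^ 2 ≤ B / (2 * η) * s ^ 2 := by gcongr
    have h15 : (2 + B) / η * s ^ 2 = η⁻¹ / 2 * (4 * s ^ 2) + B / (2 * η) * s ^ 2
        + B / (2 * η) * s ^ 2 := by field_simp; ring
    rw [h15]
    linarith
  have key2 : ∀ s : ℝ, ‖x₁ - x₀‖ < s →
      |σ i (x₁ i - y₁ i) - σ i (x₀ i - y₀ i)| ≤ (2 + B) / η * s := by
    intro s hs
    have hs0 : 0 < s := (norm_nonneg _).trans_lt hs
    have h1 := key s hs0.ne' (hs.le.trans (le_abs_self s))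
    have h2 := key (-s) (neg_ne_zero.2 hs0.ne') (by rw [abs_neg]; exact hs.le.trans (le_abs_self s))
    rw [abs_le]
    constructor <;> refine le_of_mul_le_mul_right ?_ hs0 <;> nlinarith
  by_contra! hlt
  have hC : 0 < (2 + B) / η := by positivity
  have hD : ‖x₁ - x₀‖ < |σ i (x₁ i - y₁ i) - σ i (x₀ i - y₀ i)| / ((2 + B) / η) := by
    rw [lt_div_iff₀ hC]; linarith
  obtain ⟨s, hs1, hs2⟩ := exists_between hD
  rw [lt_div_iff₀ hC] at hs2
  linarith [key2 s hs1]

end contact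

/-- Mean value estimate for the mixed second difference of `(t, y) ↦ h (t - y)`. -/
theorem abs_cross_difference_le {h σ σ' : ℝ → ℝ} (hh : ∀ t, HasDerivAt h (σ t) t)
    (hσ : ∀ t, HasDerivAt σ (σ' t) t) {X Y : Set ℝ} (hX : Convex ℝ X) (hY : Convex ℝ Y) {q δ : ℝ}
    (hq : ∀ t ∈ X, ∀ y ∈ Y, |σ' (t - y) - q| ≤ δ) {t₀ t₁ y₀ y₁ : ℝ} (ht₀ : t₀ ∈ X) (ht₁ : t₁ ∈ X)
    (hy₀ : y₀ ∈ Y) (hy₁ : y₁ ∈ Y) :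
    |(h (t₁ - y₀) - h (t₁ - y₁)) - (h (t₀ - y₀) - h (t₀ - y₁)) - q * (t₁ - t₀) * (y₁ - y₀)| ≤
      δ * |t₁ - t₀| * |y₁ - y₀| := by
  have h1 : ∀ t ∈ X, |σ (t - y₀) - σ (t - y₁) - q * (y₁ - y₀)| ≤ δ * |y₁ - y₀| := by
    intro t ht
    have hd (y : ℝ) : HasDerivAt (fun y => -σ (t - y) - q * y) (σ' (t - y) - q) y := by
      have := ((hσ (t - y)).comp_const_sub t y).neg.sub ((hasDerivAt_id y).const_mul q)
      refine this.congr_deriv ?_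
      simp
    have := hY.norm_image_sub_le_of_norm_hasDerivWithin_le (fun y _ => (hd y).hasDerivWithinAt)
      (fun y hy => hq t ht y hy) hy₀ hy₁
    rw [Real.norm_eq_abs, Real.norm_eq_abs] at this
    refine le_of_eq_of_le ?_ this
    congr 1; ring
  have hd (t : ℝ) : HasDerivAt (fun t => h (t - y₀) - h (t - y₁) - q * (y₁ - y₀) * t)
      (σ (t - y₀) - σ (t - y₁) - q * (y₁ - y₀)) t := by
    have := ((((hh (t - y₀)).comp_sub_const t y₀)).sub ((hh (t - y₁)).comp_sub_const t y₁)).sub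
      ((hasDerivAt_id t).const_mul (q * (y₁ - y₀)))
    refine this.congr_deriv ?_
    simp
  have := hX.norm_image_sub_le_of_norm_hasDerivWithin_le (fun t _ => (hd t).hasDerivWithinAt)
    (fun t ht => h1 t ht) ht₀ ht₁
  rw [Real.norm_eq_abs, Real.norm_eq_abs] at this
  refine le_of_eq_of_le ?_ (this.trans_eq ?_)
  · congr 1; ring
  · ring

/-- The diagonal map `x ↦ (x i / V i)`. -/
noncomputable def rescale {n : ℕ} (V : Fin n → ℝ) : EuclideanSpace ℝ (Fin n) →ₗ[ℝ] EuclideanSpace ℝ (Fin n) where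
  toFun x := WithLp.toLp 2 fun i => x i / V i
  map_add' x y := by ext i; simp [add_div]
  map_smul' c x := by ext i; simp [mul_div_assoc]

@[simp]
theorem rescale_apply {n : ℕ} (V : Fin n → ℝ) (x : EuclideanSpace ℝ (Fin n)) (i : Fin n) :
    rescale V x i = x i / V i := rfl

theorem rescale_injective {n : ℕ} {V : Fin n → ℝ} (hV : ∀ i, 0 < V i) :
    Function.Injective (rescale V) := by
  intro x y hxy
  ext i
  have := congrArg (fun z => z i) hxy
  simpa [(hV i).ne'] using this

theorem abs_coord_le_mul_norm_rescale {n : ℕ} {V : Fin n → ℝ} (hV : ∀ i, 0 < V i)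
    (x : EuclideanSpace ℝ (Fin n)) (i : Fin n) : |x i| ≤ V i * ‖rescale V x‖ := by
  have := abs_coord_le_norm (rescale V x) i
  rw [rescale_apply, abs_div, abs_of_pos (hV i), div_le_iff₀ (hV i)] at this
  linarith

/-! ### The barrier -/

section test_function
variable {n : ℕ} {f f' f'' : Fin n → ℝ → ℝ} {b : Fin n → ℝ} {c a d B η : ℝ} {p V : Fin n → ℝ}
  {x : EuclideanSpace ℝ (Fin n)}

theorem neg_mul_sum_sq_le_dotProduct_weightedHessian
    (hf : ∀ i t, HasDerivAt (f i) (f' i t) t) (hf' : ∀ i t, HasDerivAt (f' i) (f'' i t) t)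
    (ha : 0 ≤ a) (hV : ∀ i, 0 < V i) (hf2 : ∀ i, -(4 / V i ^ 2) ≤ f'' i (x i))
    (hG : ∀ i, |partialDeriv (separableAddSq f b a d c) x i| ^ (p i - 2) ≤ 2 * (B * V i ^ 2))
    (ζ : Fin n → ℝ) :
    -(8 * B) * ∑ i, ζ i ^ 2 ≤
      ζ ⬝ᵥ (weightedHessian p (separableAddSq f b a d c) x).mulVec ζ := by
  rw [dotProduct_weightedHessian]
  set ψ := separableAddSq f b a d c with hψ
  have hH (i j : Fin n) : hessianMatrix ψ x i j =
      (if i = j then f'' i (x i) else 0) + 2 * a * b i * b j :=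
    hessianMatrix_separableAddSq hf hf' x i j
  have hVV (i : Fin n) : V i ^ 2 * (4 / V i ^ 2) = 4 := by
    have := (hV i).ne'; field_simp
  set g : Fin n → ℝ := fun i => |partialDeriv ψ x i| ^ ((p i - 2) / 2) * ζ i with hg
  have h1 : ∑ i, ∑ j, g i * hessianMatrix ψ x i j * g j =
      ∑ i, g i ^ 2 * f'' i (x i) + 2 * a * (∑ i, g i * b i) ^ 2 := by
    simp only [hH, mul_add, add_mul, Finset.sum_add_distrib]
    congr 1
    · refine Finset.sum_congr rfl fun i _ => ?_
      simp only [mul_ite, ite_mul, mul_zero, zero_mul, Finset.sum_ite_eq, Finset.mem_univ, if_true]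
      ring
    · rw [sq, Finset.sum_mul_sum, Finset.mul_sum]
      refine Finset.sum_congr rfl fun i _ => ?_
      rw [Finset.mul_sum]
      refine Finset.sum_congr rfl fun j _ => ?_
      ring
  rw [h1]
  have h2 : 0 ≤ 2 * a * (∑ i, g i * b i) ^ 2 := by positivity
  refine le_trans ?_ (le_add_of_nonneg_right h2)
  rw [Finset.mul_sum]
  refine Finset.sum_le_sum fun i _ => ?_
  have h3 : g i ^ 2 = |partialDeriv ψ x i| ^ (p i - 2) * ζ i ^ 2 := by
    rw [hg, mul_pow, sq (|partialDeriv ψ x i| ^ _), rpow_half_mul_self (abs_nonneg _)]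
  have h5 : g i ^ 2 ≤ 2 * (B * V i ^ 2) * ζ i ^ 2 := by
    rw [h3]; exact mul_le_mul_of_nonneg_right (hG i) (sq_nonneg _)
  calc -(8 * B) * ζ i ^ 2 = -(2 * (B * V i ^ 2) * ζ i ^ 2 * (4 / V i ^ 2)) := by
        linear_combination (2 * B * ζ i ^ 2) * (hVV i)
    _ ≤ -(g i ^ 2 * (4 / V i ^ 2)) := by
        have := hV i
        gcongr
    _ = g i ^ 2 * -(4 / V i ^ 2) := by ring
    _ ≤ g i ^ 2 * f'' i (x i) := mul_le_mul_of_nonneg_left (hf2 i) (sq_nonneg _)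

theorem sub_le_sum_weight_mul_hessianMatrix
    (hf : ∀ i t, HasDerivAt (f i) (f' i t) t) (hf' : ∀ i t, HasDerivAt (f' i) (f'' i t) t)
    (ha : 0 ≤ a) (hB : 0 ≤ B) (hV : ∀ i, 0 < V i) (hf2 : ∀ i, -(4 / V i ^ 2) ≤ f'' i (x i))
    {e : EuclideanSpace ℝ (Fin n)} (he : ‖e‖ = 1) (hb : ∀ i, b i = e i / V i)
    (hG : ∀ i, B * V i ^ 2 / 2 ≤
        |partialDeriv (separableAddSq f b a d c) x i| ^ (p i - 2) + η ∧
      |partialDeriv (separableAddSq f b a d c) x i| ^ (p i - 2) + η ≤ 2 * (B * V i ^ 2)) :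
    a * B - 8 * n * B ≤ ∑ i, (|partialDeriv (separableAddSq f b a d c) x i| ^ (p i - 2) + η) *
      hessianMatrix (separableAddSq f b a d c) x i i := by
  have hVV (i : Fin n) : V i ^ 2 * (4 / V i ^ 2) = 4 := by
    have := (hV i).ne'; field_simp
  have h1 (i : Fin n) : a * B * e i ^ 2 - 8 * B ≤
      (|partialDeriv (separableAddSq f b a d c) x i| ^ (p i - 2) + η) *
        hessianMatrix (separableAddSq f b a d c) x i i := by
    obtain ⟨hl, hu⟩ := hG i
    set W := |partialDeriv (separableAddSq f b a d c) x i| ^ (p i - 2) + η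
    rw [hessianMatrix_separableAddSq hf hf', if_pos rfl, mul_add]
    have hW : 0 ≤ W := le_trans (by positivity) hl
    have h2 : -(8 * B) ≤ W * f'' i (x i) := by
      calc -(8 * B) = -(2 * (B * V i ^ 2) * (4 / V i ^ 2)) := by
            linear_combination (2 * B) * (hVV i)
        _ ≤ -(W * (4 / V i ^ 2)) := by
            have := hV i
            gcongr
        _ = W * -(4 / V i ^ 2) := by ring
        _ ≤ W * f'' i (x i) := mul_le_mul_of_nonneg_left (hf2 i) hW
    have h3 : a * B * e i ^ 2 ≤ W * (2 * a * b i * b i) := by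
      calc a * B * e i ^ 2 = B * V i ^ 2 / 2 * (2 * a * b i ^ 2) := by
            have := (hV i).ne'
            rw [hb]; field_simp
        _ ≤ W * (2 * a * b i ^ 2) := by gcongr
        _ = _ := by ring
    linarith
  have h2 := Finset.sum_le_sum fun i (_ : i ∈ Finset.univ) => h1 i
  have h3 : ∑ i, e i ^ 2 = 1 := by rw [← EuclideanSpace.real_norm_sq_eq, he, one_pow]
  rw [Finset.sum_sub_distrib, ← Finset.mul_sum, h3] at h2
  simp only [Finset.sum_const, Finset.card_univ, Fintype.card_fin, nsmul_eq_mul] at h2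
  linarith

end test_function

set_option maxHeartbeats 1000000 in
/-- The barrier argument. Near a base point `(xb, yb)` the profiles have second derivatives close to
`1 / V i ^ 2`. If the centres `y₀`, `y₁` of two contact points were much further apart than the points
`x₀`, `x₁`, both measured after rescaling by `V`, then in the direction `e` of `y₁ - y₀` the contact
function of `x₁` would rise above that of `x₀` with large slope. This leaves room to touch `v` from
below, near `x₀`, by the contact function of `x₀` plus `a (s + r) ^ 2 - |x̂| ^ 2`, where `x̂` is the
rescaled displacement from `x₀`, `s = ⟪e, x̂⟫` and `r = |x̂₁|`. For large `a` this test function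
violates the trace bound. -/
theorem barrier_contradiction {n : ℕ} {p : Fin n → ℝ} {η B a R C ρ : ℝ}
    {h σ : Fin n → ℝ → ℝ} {v : EuclideanSpace ℝ (Fin n) → ℝ}
    {Ω : Set (EuclideanSpace ℝ (Fin n))} {V : Fin n → ℝ}
    {x₀ y₀ x₁ y₁ xb yb : EuclideanSpace ℝ (Fin n)}
    (hp : ∀ i, 2 ≤ p i) (hη : 0 < η) (hB : 0 < B)
    (H : ∀ i, IsProfile (p i) η B (h i) (σ i)) (hv : Continuous v)
    (htr : HasTraceBound p η (8 * B) (2 * B + 2) C Ω v)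
    (hR1 : 1 ≤ R) (hR : R ^ 2 = 25 * a) (hC : C < a * B - 8 * n * B)
    (hV : ∀ i, 0 < V i) (hc₀ : IsContactPair h v x₀ y₀) (hc₁ : IsContactPair h v x₁ y₁)
    (hx : 0 < ‖rescale V (x₁ - x₀)‖)
    (hbig : 8 * a * R * ‖rescale V (x₁ - x₀)‖ < ‖rescale V (y₁ - y₀)‖)
    -- the second derivative of the profile is almost constant near the base point
    (hσ : ∀ i, ∀ t : ℝ, |t - (xb i - yb i)| ≤ ρ →
      |B / (|σ i t| ^ (p i - 2) + η) - (V i ^ 2)⁻¹| ≤ (R + 1)⁻¹ * (V i ^ 2)⁻¹)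
    (hnear : ∀ x, ‖rescale V (x - x₀)‖ ≤ R * ‖rescale V (x₁ - x₀)‖ →
      x ∈ Ω ∧ v x ≤ 2 ∧ ∀ i, |x i - xb i| ≤ ρ / 2)
    (hy₀ : ∀ i, |y₀ i - yb i| ≤ ρ / 2) (hy₁ : ∀ i, |y₁ i - yb i| ≤ ρ / 2)
    (hgrad : ∀ x, ‖rescale V (x - x₀)‖ ≤ R * ‖rescale V (x₁ - x₀)‖ → ∀ i, ∀ s : ℝ,
      |s| ≤ (2 * R + 2 * a * (R + 1)) * ‖rescale V (x₁ - x₀)‖ / V i →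
      |-σ i (x i - y₀ i) + s| ≤ 2 * B + 2 ∧
      B * V i ^ 2 / 2 ≤ |-σ i (x i - y₀ i) + s| ^ (p i - 2) + η ∧
      |-σ i (x i - y₀ i) + s| ^ (p i - 2) + η ≤ 2 * (B * V i ^ 2)) : False := by
  set r := ‖rescale V (x₁ - x₀)‖ with hr
  have ha : 0 < a := by nlinarith
  have hyy : 0 < ‖rescale V (y₁ - y₀)‖ := lt_of_le_of_lt (by positivity) hbig
  set e : EuclideanSpace ℝ (Fin n) := ‖rescale V (y₁ - y₀)‖⁻¹ • rescale V (y₁ - y₀) with he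
  have he1 : ‖e‖ = 1 := by
    rw [he, norm_smul, norm_inv, norm_norm, inv_mul_cancel₀ hyy.ne']
  set b : Fin n → ℝ := fun i => e i / V i with hb
  set s : EuclideanSpace ℝ (Fin n) → ℝ := fun x => inner ℝ e (rescale V (x - x₀)) with hs
  set d : ℝ := r - ∑ i, b i * x₀ i with hd
  have hsb (x : EuclideanSpace ℝ (Fin n)) : ∑ i, b i * x i + d = s x + r := by
    have : s x = ∑ i, (b i * x i - b i * x₀ i) := by
      rw [hs]
      simp only [PiLp.inner_apply, rescale_apply, PiLp.sub_apply, hb]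
      refine Finset.sum_congr rfl fun i _ => ?_
      simp; ring
    rw [this, Finset.sum_sub_distrib, hd]; ring
  have hs_le (x : EuclideanSpace ℝ (Fin n)) : |s x| ≤ ‖rescale V (x - x₀)‖ := by
    have := abs_real_inner_le_norm e (rescale V (x - x₀))
    rwa [he1, one_mul] at this
  set f : Fin n → ℝ → ℝ := fun i t => -h i (t - y₀ i) - (t - x₀ i) ^ 2 / V i ^ 2 with hf
  set f' : Fin n → ℝ → ℝ := fun i t => -σ i (t - y₀ i) - 2 * (t - x₀ i) / V i ^ 2 with hf'
  set f'' : Fin n → ℝ → ℝ := fun i t =>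
    -(B / (|σ i (t - y₀ i)| ^ (p i - 2) + η)) - 2 / V i ^ 2 with hf''
  have hff' (i : Fin n) (t : ℝ) : HasDerivAt (f i) (f' i t) t := by
    have h1 := (((H i).hasDerivAt (t - y₀ i)).comp_sub_const t (y₀ i)).neg
    have h2 := (((hasDerivAt_id t).sub_const (x₀ i)).pow 2).div_const (V i ^ 2)
    refine (h1.sub h2).congr_deriv ?_
    simp [hf']
  have hff'' (i : Fin n) (t : ℝ) : HasDerivAt (f' i) (f'' i t) t := by
    have h1 := (((H i).hasDerivAt_deriv (t - y₀ i)).comp_sub_const t (y₀ i)).neg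
    have h2 := (((hasDerivAt_id t).sub_const (x₀ i)).const_mul 2).div_const (V i ^ 2)
    refine (h1.sub h2).congr_deriv ?_
    simp [hf'']
  set c : ℝ := v x₀ + ∑ i, h i (x₀ i - y₀ i) with hcdef
  set ψ := separableAddSq f b a d c with hψ
  have hψC : ContDiff ℝ 2 ψ := by
    refine contDiff_separableAddSq fun i => ?_
    exact (((H i).contDiff (hp i) hη).comp (contDiff_id.sub contDiff_const)).neg.sub
      (((contDiff_id.sub contDiff_const).pow 2).div_const _)
  have hψval (x : EuclideanSpace ℝ (Fin n)) : ψ x = c - ∑ i, h i (x i - y₀ i)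
      - ‖rescale V (x - x₀)‖ ^ 2 + a * (s x + r) ^ 2 := by
    have h1 : ‖rescale V (x - x₀)‖ ^ 2 = ∑ i, (x i - x₀ i) ^ 2 / V i ^ 2 := by
      rw [EuclideanSpace.real_norm_sq_eq]
      simp [-map_sub, div_pow]
    rw [hψ, separableAddSq, hsb, h1]
    simp only [hf, Finset.sum_sub_distrib, Finset.sum_neg_distrib]
    ring
  have hrc : Continuous fun x => rescale V (x - x₀) :=
    (rescale V).continuous_of_finiteDimensional.comp (continuous_id.sub continuous_const)
  have hsc : Continuous s := continuous_const.inner hrc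
  set D : Set (EuclideanSpace ℝ (Fin n)) := {x | ‖rescale V (x - x₀)‖ ≤ R * r ∧ -r ≤ s x} with hD
  have hDcl : IsClosed D :=
    (isClosed_le hrc.norm continuous_const).inter (isClosed_le continuous_const hsc)
  have hDc : IsCompact D := by
    have h1 := (isCompact_centeredBox fun i => V i * (R * r)).image (continuous_add_const x₀)
    refine h1.of_isClosed_subset hDcl fun x hx => ⟨x - x₀, fun i => ?_, by simp⟩
    refine (abs_coord_le_mul_norm_rescale hV _ i).trans ?_
    exact mul_le_mul_of_nonneg_left hx.1 (hV i).le
  have hx0D : x₀ ∈ D := by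
    refine ⟨?_, ?_⟩
    · rw [sub_self, map_zero, norm_zero]; positivity
    · simp only [hs, sub_self, map_zero, inner_zero_right]; linarith
  obtain ⟨x, hxD, hxmin⟩ := hDc.exists_isMinOn ⟨x₀, hx0D⟩ (hv.sub hψC.continuous).continuousOn
  have hneg : v x < ψ x := by
    have h1 : v x - ψ x ≤ v x₀ - ψ x₀ := hxmin hx0D
    have h2 : ψ x₀ = v x₀ + a * r ^ 2 := by
      rw [hψval]; simp [hs, hcdef]
    have h3 : 0 < a * r ^ 2 := by positivity
    linarith
  have hlow₀ := hc₀ x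
  have hpsix := hψval x
  have hxx : ‖rescale V (x - x₀)‖ ≤ R * r := hxD.1
  have hRr : ‖rescale V (x₁ - x₀)‖ ≤ R * ‖rescale V (x₁ - x₀)‖ := by
    rw [← hr]; nlinarith
  -- on the face `s = -r` the barrier is not positive
  have hsgt : -r < s x := by
    refine lt_of_le_of_ne hxD.2 fun heq => ?_
    rw [← heq, neg_add_cancel] at hpsix
    have := sq_nonneg ‖rescale V (x - x₀)‖
    linarith
  -- on the sphere the barrier is not positive for `s ≤ 4 r`, as `R ^ 2 = 25 a`
  have hlt : ‖rescale V (x - x₀)‖ < R * r := by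
    refine lt_of_le_of_ne hxx fun heq => ?_
    rw [heq] at hpsix
    -- for `s ≥ 4 r` the contact function of `x₁` dominates the barrier
    rcases le_total (s x) (4 * r) with hcase | hcase
    · have : a * (s x + r) ^ 2 ≤ (R * r) ^ 2 := by
        calc a * (s x + r) ^ 2 ≤ a * (5 * r) ^ 2 := by
              have : 0 ≤ s x + r := by linarith
              gcongr; linarith
          _ = (R * r) ^ 2 := by rw [mul_pow R, hR]; ring
      linarith
    · have h1 := hc₁ x
      have h2 := hc₀ x₁
      have h3 (i : Fin n) : (x i - x₁ i) / V i * ((y₁ i - y₀ i) / V i)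
          - (R + 1)⁻¹ * (|(x i - x₁ i) / V i| * |(y₁ i - y₀ i) / V i|) ≤
          (h i (x i - y₀ i) - h i (x i - y₁ i)) - (h i (x₁ i - y₀ i) - h i (x₁ i - y₁ i)) := by
        have h4 := abs_cross_difference_le (q := (V i ^ 2)⁻¹) (δ := (R + 1)⁻¹ * (V i ^ 2)⁻¹)
          (H i).hasDerivAt (H i).hasDerivAt_deriv
          (convex_closedBall (xb i) (ρ / 2)) (convex_closedBall (yb i) (ρ / 2))
          (fun t ht y hy => hσ i (t - y) ?_)
          (t₀ := x₁ i) (t₁ := x i) (y₀ := y₀ i) (y₁ := y₁ i)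
          ((hnear x₁ hRr).2.2 i) ((hnear x hxx).2.2 i) (hy₀ i) (hy₁ i)
        · have h5 := (abs_le.1 h4).1
          have h6 : (x i - x₁ i) / V i * ((y₁ i - y₀ i) / V i)
            = (V i ^ 2)⁻¹ * (x i - x₁ i) * (y₁ i - y₀ i) := by
            have := (hV i).ne'
            field_simp
          have h7 : (R + 1)⁻¹ * (|(x i - x₁ i) / V i| * |(y₁ i - y₀ i) / V i|)
            = (R + 1)⁻¹ * (V i ^ 2)⁻¹ * |x i - x₁ i| * |y₁ i - y₀ i| := by
            rw [abs_div, abs_div, abs_of_pos (hV i)]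
            have := (hV i).ne'
            field_simp
          rw [h6, h7]; linarith
        · rw [Metric.mem_closedBall, Real.dist_eq] at ht hy
          have : t - y - (xb i - yb i) = (t - xb i) - (y - yb i) := by ring
          rw [this]
          exact (abs_sub _ _).trans (by linarith)
      have h4 := Finset.sum_le_sum fun i (_ : i ∈ Finset.univ) => h3 i
      simp only [Finset.sum_sub_distrib, ← Finset.mul_sum] at h4
      have h5 : ∑ i, (x i - x₁ i) / V i * ((y₁ i - y₀ i) / V i)
          = inner ℝ (rescale V (y₁ - y₀)) (rescale V (x - x₁)) := by
        simp [-map_sub, PiLp.inner_apply]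
      have h6 : ∑ i, |(x i - x₁ i) / V i| * |(y₁ i - y₀ i) / V i| ≤
          ‖rescale V (x - x₁)‖ * ‖rescale V (y₁ - y₀)‖ := by
        have := Real.sum_mul_le_sqrt_mul_sqrt Finset.univ
          (fun i => |(x i - x₁ i) / V i|) (fun i => |(y₁ i - y₀ i) / V i|)
        refine this.trans (le_of_eq ?_)
        simp only [EuclideanSpace.norm_eq, Real.norm_eq_abs, rescale_apply, PiLp.sub_apply]
      have h7 : rescale V (x - x₁) = rescale V (x - x₀) - rescale V (x₁ - x₀) := by
        rw [← map_sub]; congr 1; abel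
      have h8 : ‖rescale V (x - x₁)‖ ≤ (R + 1) * r := by
        rw [h7]; refine (norm_sub_le _ _).trans ?_; linarith
      have h9 : rescale V (y₁ - y₀) = ‖rescale V (y₁ - y₀)‖ • e := by
        rw [he, smul_smul, mul_inv_cancel₀ hyy.ne', one_smul]
      have h10 : inner ℝ (rescale V (y₁ - y₀)) (rescale V (x - x₁))
          = ‖rescale V (y₁ - y₀)‖ * (s x - s x₁) := by
        conv_lhs => rw [h9]
        rw [real_inner_smul_left, h7, inner_sub_right]
      have h11 := (abs_le.1 (hs_le x₁)).2
      have h12 : (R + 1)⁻¹ * ∑ i, |(x i - x₁ i) / V i| * |(y₁ i - y₀ i) / V i| ≤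
          r * ‖rescale V (y₁ - y₀)‖ := by
        rw [inv_mul_le_iff₀ (by linarith)]
        refine h6.trans ?_
        rw [← mul_assoc]
        gcongr
      rw [h5, h10] at h4
      have h13 : 8 * a * R * r * (s x / 2) ≤ ‖rescale V (y₁ - y₀)‖ * (s x / 2) := by
        have : 0 ≤ s x := le_trans (by positivity) hcase
        gcongr
      have h14 : ‖rescale V (y₁ - y₀)‖ * (s x / 2) ≤ ‖rescale V (y₁ - y₀)‖ * (s x - s x₁)
          - r * ‖rescale V (y₁ - y₀)‖ := by
        have : ‖rescale V (y₁ - y₀)‖ * (s x / 2) ≤ ‖rescale V (y₁ - y₀)‖ * (s x - r - r) := by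
          gcongr; linarith
        nlinarith
      have h15 : a * (s x + r) ^ 2 ≤ 8 * a * R * r * (s x / 2) := by
        have h16 : s x ≤ R * r := by
          have := (abs_le.1 (hs_le x)).2; linarith
        have h17 : 0 ≤ s x := le_trans (by positivity) hcase
        have h18 : (s x + r) ^ 2 ≤ (2 * s x) ^ 2 := by gcongr; linarith
        calc a * (s x + r) ^ 2 ≤ a * (2 * s x) ^ 2 := by gcongr
          _ = 4 * a * s x * s x := by ring
          _ ≤ 4 * a * s x * (R * r) := by gcongr
          _ = _ := by ring
      have h19 := sq_nonneg (R * r)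
      linarith
  have hloc : IsLocalMin (fun x => v x - ψ x) x := by
    have h1 : ∀ᶠ z in 𝓝 x, z ∈ D := by
      filter_upwards [(hrc.norm.tendsto x).eventually_lt_const hlt,
        (hsc.tendsto x).eventually_const_lt hsgt] with z hz1 hz2
      exact ⟨hz1.le, hz2.le⟩
    filter_upwards [h1] with z hz using hxmin hz
  obtain ⟨hxΩ, hvx, -⟩ := hnear x hxx
  set q : Fin n → ℝ := fun i => -2 * (x i - x₀ i) / V i ^ 2 + 2 * a * (s x + r) * b i with hq
  have hpart (i : Fin n) : partialDeriv ψ x i = -σ i (x i - y₀ i) + q i := by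
    rw [hψ, partialDeriv_separableAddSq hff', hsb]
    simp only [hf', hq]; ring
  have hqle (i : Fin n) : |q i| ≤ (2 * R + 2 * a * (R + 1)) * r / V i := by
    have h1 : |(x i - x₀ i) / V i| ≤ R * r := (abs_coord_le_norm (rescale V (x - x₀)) i).trans hxx
    have h2 : |e i| ≤ 1 := he1 ▸ abs_coord_le_norm e i
    have h3 : |s x + r| ≤ (R + 1) * r := by
      rw [abs_of_pos (by linarith)]
      have := (abs_le.1 (hs_le x)).2; linarith
    have h4 : q i = (-2 * ((x i - x₀ i) / V i) + 2 * a * ((s x + r) * e i)) / V i := by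
      have := (hV i).ne'
      simp only [hq, hb]; field_simp
    rw [h4, abs_div, abs_of_pos (hV i)]
    refine div_le_div_of_nonneg_right ?_ (hV i).le
    refine (abs_add_le _ _).trans ?_
    rw [abs_mul, abs_mul (2 * a), abs_of_pos (by positivity : 0 < 2 * a), abs_mul (s x + r)]
    have h5 : |s x + r| * |e i| ≤ (R + 1) * r * 1 := by gcongr
    have h6 : |(-2 : ℝ)| = 2 := by norm_num
    rw [h6]
    nlinarith
  have hG (i : Fin n) := hgrad x hxx i (q i) (hqle i)
  simp only [← hpart] at hG
  have hf2 (i : Fin n) : -(4 / V i ^ 2) ≤ f'' i (x i) := by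
    have h1 := hσ i (x i - y₀ i) (by
      have : x i - y₀ i - (xb i - yb i) = (x i - xb i) - (y₀ i - yb i) := by ring
      rw [this]
      exact (abs_sub _ _).trans (by linarith [(hnear x hxx).2.2 i, hy₀ i]))
    have h2 := (abs_le.1 h1).2
    have h3 : (R + 1)⁻¹ * (V i ^ 2)⁻¹ ≤ 1 * (V i ^ 2)⁻¹ := by
      gcongr; exact inv_le_one_of_one_le₀ (by linarith)
    have h4 : 4 / V i ^ 2 = 2 * (V i ^ 2)⁻¹ + 2 / V i ^ 2 := by ring
    simp only [hf'']
    linarith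
  refine absurd (htr x hxΩ hvx ψ hψC hloc (fun i => (hG i).1) fun ζ => ?_) (not_le.2 ?_)
  · exact neg_mul_sum_sq_le_dotProduct_weightedHessian hff' hff'' ha.le hV hf2
      (fun i => by linarith [(hG i).2.2]) ζ
  · refine hC.trans_le (sub_le_sum_weight_mul_hessianMatrix hff' hff'' ha.le hB.le hV hf2
      he1 (fun i => rfl) (fun i => (hG i).2))

/-! ### Lipschitz dependence of the centre on the contact point -/

theorem eventually_forall_dist_le {X : Type*} [PseudoMetricSpace X] {x₀ : X} {P : X → Prop}
    (h : ∀ᶠ x in 𝓝 x₀, P x) : ∀ᶠ ρ : ℝ in 𝓝[>] 0, ∀ x, dist x x₀ ≤ ρ → P x := by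
  obtain ⟨r, hr, hP⟩ := Metric.eventually_nhds_iff.1 h
  filter_upwards [Ioo_mem_nhdsGT hr] with ρ hρ x hx using hP (hx.trans_lt hρ.2)

theorem eventually_mul_le (c : ℝ) {d : ℝ} (hd : 0 < d) : ∀ᶠ ρ : ℝ in 𝓝[>] 0, c * ρ ≤ d := by
  have h : Tendsto (fun ρ : ℝ => c * ρ) (𝓝 0) (𝓝 0) := by
    have := (continuous_const_mul c).tendsto (0 : ℝ)
    simpa using this
  exact (h.mono_left nhdsWithin_le_nhds).eventually (eventually_le_nhds hd)

/-- Near each contact point, after the rescaling by `V i = (h i'') ^ (-1 / 2)` taken at that point, the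
map from contact points to centres is Lipschitz with the constant `8 a R`, independent of `η`. -/
theorem exists_rescale_lipschitz {n : ℕ} {p : Fin n → ℝ} {η B a R C : ℝ}
    {h σ : Fin n → ℝ → ℝ} {v : EuclideanSpace ℝ (Fin n) → ℝ}
    {Ω : Set (EuclideanSpace ℝ (Fin n))} {xb yb : EuclideanSpace ℝ (Fin n)}
    (hp : ∀ i, 2 ≤ p i) (hη : 0 < η) (hη1 : η ≤ 1) (hB : 0 < B)
    (H : ∀ i, IsProfile (p i) η B (h i) (σ i)) (hv : Continuous v)
    (hsc : ∀ x₀, ∃ c, ∀ x, v x ≤ v x₀ + inner ℝ c (x - x₀) + η⁻¹ / 2 * ‖x - x₀‖ ^ 2)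
    (htr : HasTraceBound p η (8 * B) (2 * B + 2) C Ω v)
    (hR1 : 1 ≤ R) (hR : R ^ 2 = 25 * a) (hC : C < a * B - 8 * n * B)
    (hΩ : Ω ∈ 𝓝 xb) (hvb : v xb < 2) (hcb : IsContactPair h v xb yb)
    (htb : ∀ i, |xb i - yb i| ≤ 2) :
    ∃ V : Fin n → ℝ, (∀ i, 0 < V i) ∧ ∃ ρ > 0, ∀ x₀ y₀ x₁ y₁,
      IsContactPair h v x₀ y₀ → (∀ i, |x₀ i - y₀ i| ≤ 2) → dist x₀ xb ≤ ρ →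
      IsContactPair h v x₁ y₁ → (∀ i, |x₁ i - y₁ i| ≤ 2) → dist x₁ xb ≤ ρ →
      ‖rescale V (y₁ - y₀)‖ ≤ 8 * a * R * ‖rescale V (x₁ - x₀)‖ := by
  have ha : 0 < a := by nlinarith
  set w : Fin n → ℝ := fun i => |σ i (xb i - yb i)| ^ (p i - 2) + η with hw
  have hw0 (i : Fin n) : 0 < w i := IsProfile.weight_pos hη _
  set V : Fin n → ℝ := fun i => √(w i / B) with hVdef
  have hV (i : Fin n) : 0 < V i := Real.sqrt_pos.2 (div_pos (hw0 i) hB)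
  have hV2 (i : Fin n) : V i ^ 2 = w i / B := Real.sq_sqrt (div_pos (hw0 i) hB).le
  have hBV (i : Fin n) : B * V i ^ 2 = w i := by rw [hV2]; field_simp
  have hweight (i : Fin n) : ∀ᶠ s in 𝓝 (-σ i (xb i - yb i)), |s| ≤ 2 * B + 2 ∧
      B * V i ^ 2 / 2 ≤ |s| ^ (p i - 2) + η ∧ |s| ^ (p i - 2) + η ≤ 2 * (B * V i ^ 2) := by
    have h1 := (IsProfile.continuous_weight (η := η) (hp i)).tendsto (-σ i (xb i - yb i))
    rw [abs_neg] at h1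
    have h2 := (continuous_abs (G := ℝ)).tendsto (-σ i (xb i - yb i))
    rw [abs_neg] at h2
    have h3 := (H i).abs_deriv_le _ (htb i)
    have h4 := hw0 i
    rw [hBV]
    filter_upwards [h2.eventually_lt_const (show _ < 2 * B + 2 by linarith),
      h1.eventually_const_lt (show w i / 2 < w i by linarith),
      h1.eventually_lt_const (show w i < 2 * w i by linarith)] with s a1 a2 a3
    exact ⟨a1.le, a2.le, a3.le⟩
  -- radius on which the weights change by a factor of at most two
  obtain ⟨ρ₂, hρ₂, hρ₂0⟩ := ((eventually_all.2 fun i =>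
    eventually_forall_dist_le (hweight i)).and self_mem_nhdsWithin).exists
  have hderiv (i : Fin n) : ∀ᶠ t in 𝓝 (xb i - yb i),
      |B / (|σ i t| ^ (p i - 2) + η) - (V i ^ 2)⁻¹| ≤ (R + 1)⁻¹ * (V i ^ 2)⁻¹ ∧
      |σ i t - σ i (xb i - yb i)| ≤ ρ₂ / 2 := by
    have h1 := ((H i).continuous_deriv2 (hp i) hη).tendsto (xb i - yb i)
    have h2 : B / (|σ i (xb i - yb i)| ^ (p i - 2) + η) = (V i ^ 2)⁻¹ := by
      rw [hV2, inv_div]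
    rw [h2] at h1
    have h3 : 0 < (R + 1)⁻¹ * (V i ^ 2)⁻¹ := by
      have := hV i
      positivity
    filter_upwards [Metric.tendsto_nhds.1 h1 _ h3,
      Metric.tendsto_nhds.1 ((H i).continuous_deriv.tendsto _) _ (half_pos hρ₂0)] with t a1 a2
    exact ⟨a1.le, a2.le⟩
  -- radius on which the second derivatives of the profiles are almost constant
  obtain ⟨ρ₁, hρ₁, hρ₁0⟩ := ((eventually_all.2 fun i =>
    eventually_forall_dist_le (hderiv i)).and self_mem_nhdsWithin).exists
  have hloc : ∀ᶠ x in 𝓝 xb, x ∈ Ω ∧ v x ≤ 2 ∧ ∀ i, |x i - xb i| ≤ ρ₁ / 2 := by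
    filter_upwards [hΩ, (hv.tendsto xb).eventually_lt_const hvb,
      Metric.ball_mem_nhds xb (half_pos hρ₁0)] with x a1 a2 a3
    refine ⟨a1, a2.le, fun i => ?_⟩
    have := abs_coord_le_norm (x - xb) i
    rw [Metric.mem_ball, dist_eq_norm] at a3
    rw [PiLp.sub_apply] at this
    linarith
  obtain ⟨ρ₃, hρ₃, hρ₃0⟩ := ((eventually_forall_dist_le hloc).and self_mem_nhdsWithin).exists
  set N := ‖(rescale V).toContinuousLinearMap‖
  have hN (z : EuclideanSpace ℝ (Fin n)) : ‖rescale V z‖ ≤ N * ‖z‖ :=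
    (rescale V).toContinuousLinearMap.le_opNorm z
  set N' := ‖(rescale (fun i => (V i)⁻¹)).toContinuousLinearMap‖
  have hN' (z : EuclideanSpace ℝ (Fin n)) : ‖z‖ ≤ N' * ‖rescale V z‖ := by
    have h1 : rescale (fun i => (V i)⁻¹) (rescale V z) = z := by
      ext i
      have := (hV i).ne'
      simp [this]
    have h2 := (rescale (fun i => (V i)⁻¹)).toContinuousLinearMap.le_opNorm (rescale V z)
    change ‖rescale (fun i => (V i)⁻¹) (rescale V z)‖ ≤ _ at h2
    rwa [h1] at h2
  have hN0 : 0 ≤ N := norm_nonneg _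
  have hN'0 : 0 ≤ N' := norm_nonneg _
  set k : Fin n → ℝ := fun i => ((2 * B + 1) ^ (p i - 2) + 1) / B with hk
  have hk0 (i : Fin n) : 0 ≤ k i := by
    have := Real.rpow_nonneg (by linarith : (0 : ℝ) ≤ 2 * B + 1) (p i - 2)
    positivity
  obtain ⟨ρ, ⟨⟨hρa, hρb⟩, hρc⟩, hρ0⟩ := ((((eventually_mul_le (1 + N' * R * N * 2) hρ₃0).and
    (eventually_all.2 fun i => eventually_mul_le (1 + k i * ((2 + B) / η)) (half_pos hρ₁0))).and
    (eventually_all.2 fun i => eventually_mul_le ((2 * R + 2 * a * (R + 1)) * (2 * N) / V i)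
      (half_pos hρ₂0))).and self_mem_nhdsWithin).exists
  have hmod {x y x' y' : EuclideanSpace ℝ (Fin n)} (hc : IsContactPair h v x y)
      (ht : ∀ i, |x i - y i| ≤ 2) (hc' : IsContactPair h v x' y') (ht' : ∀ i, |x' i - y' i| ≤ 2)
      (i : Fin n) : |y i - y' i| ≤ (1 + k i * ((2 + B) / η)) * ‖x - x'‖ := by
    have h1 := hc'.abs_deriv_sub_le hp hη hB H hsc hc i
    have h2 := (H i).abs_sub_le (hp i) hη hη1 hB (ht i) (ht' i)
    have h3 := abs_coord_le_norm (x - x') i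
    rw [PiLp.sub_apply] at h3
    have h4 : y i - y' i = (x i - x' i) - ((x i - y i) - (x' i - y' i)) := by ring
    have h5 : k i * |σ i (x i - y i) - σ i (x' i - y' i)| ≤ k i * ((2 + B) / η * ‖x - x'‖) :=
      mul_le_mul_of_nonneg_left h1 (hk0 i)
    rw [h4]
    refine (abs_sub _ _).trans ?_
    linarith
  have hmodb {x y : EuclideanSpace ℝ (Fin n)} (hc : IsContactPair h v x y)
      (ht : ∀ i, |x i - y i| ≤ 2) (hx : dist x xb ≤ ρ) (i : Fin n) : |y i - yb i| ≤ ρ₁ / 2 := by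
    refine (hmod hc ht hcb htb i).trans (le_trans ?_ (hρb i))
    rw [← dist_eq_norm]
    have := hk0 i
    gcongr
  refine ⟨V, hV, ρ, hρ0, fun x₀ y₀ x₁ y₁ hc₀ ht₀ hx₀ hc₁ ht₁ hx₁ => ?_⟩
  rcases eq_or_ne x₁ x₀ with heq | hne
  · have : y₁ = y₀ := by
      ext i
      have := hmod hc₁ ht₁ hc₀ ht₀ i
      rw [heq, sub_self, norm_zero, mul_zero, abs_nonpos_iff, sub_eq_zero] at this
      exact this
    simp [heq, this]
  by_contra! hbig
  have hr : 0 < ‖rescale V (x₁ - x₀)‖ := by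
    rw [norm_pos_iff, ← map_zero (rescale V)]
    exact (rescale_injective hV).ne (sub_ne_zero.2 hne)
  have hrρ : ‖rescale V (x₁ - x₀)‖ ≤ 2 * N * ρ := by
    have h1 := dist_triangle_right x₁ x₀ xb
    rw [dist_eq_norm x₁ x₀] at h1
    calc _ ≤ N * ‖x₁ - x₀‖ := hN _
      _ ≤ N * (ρ + ρ) := by gcongr; linarith
      _ = _ := by ring
  have hnear : ∀ x, ‖rescale V (x - x₀)‖ ≤ R * ‖rescale V (x₁ - x₀)‖ →
      x ∈ Ω ∧ v x ≤ 2 ∧ ∀ i, |x i - xb i| ≤ ρ₁ / 2 := by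
    intro x hx
    refine hρ₃ x ?_
    have h1 := dist_triangle x x₀ xb
    have h2 : dist x x₀ ≤ N' * (R * (2 * N * ρ)) := by
      rw [dist_eq_norm]
      refine (hN' _).trans ?_
      gcongr
      exact hx.trans (by gcongr)
    linarith
  refine barrier_contradiction hp hη hB H hv htr hR1 hR hC hV hc₀ hc₁ hr hbig
    (fun i t ht => (hρ₁ i t ht).1) hnear (hmodb hc₀ ht₀ hx₀) (hmodb hc₁ ht₁ hx₁) ?_
  intro x hx i s hs
  refine hρ₂ i _ ?_
  have h1 : |(x i - y₀ i) - (xb i - yb i)| ≤ ρ₁ := by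
    have : (x i - y₀ i) - (xb i - yb i) = (x i - xb i) - (y₀ i - yb i) := by ring
    rw [this]
    exact (abs_sub _ _).trans (by linarith [(hnear x hx).2.2 i, hmodb hc₀ ht₀ hx₀ i])
  have h2 := (hρ₁ i _ h1).2
  have h3 : |s| ≤ ρ₂ / 2 := by
    refine hs.trans (le_trans ?_ (hρc i))
    have := hV i
    calc (2 * R + 2 * a * (R + 1)) * ‖rescale V (x₁ - x₀)‖ / V i ≤
        (2 * R + 2 * a * (R + 1)) * (2 * N * ρ) / V i := by gcongr
      _ = _ := by ring
  rw [Real.dist_eq]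
  have h4 : -σ i (x i - y₀ i) + s - -σ i (xb i - yb i) =
      s - (σ i (x i - y₀ i) - σ i (xb i - yb i)) := by ring
  rw [h4]
  exact (abs_sub _ _).trans (by linarith)

/-! ### Volume under locally rescaled Lipschitz relations -/

theorem volume_image_le_of_lipschitzOnWith {n : ℕ} {K : NNReal}
    {f : EuclideanSpace ℝ (Fin n) → EuclideanSpace ℝ (Fin n)} {s : Set (EuclideanSpace ℝ (Fin n))}
    (hf : LipschitzOnWith K f s) : volume (f '' s) ≤ (K : ENNReal) ^ n * volume s := by
  have h1 := Measure.isAddLeftInvariant_eq_smul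
    (volume : Measure (EuclideanSpace ℝ (Fin n))) (Measure.hausdorffMeasure n)
  have h2 := hf.hausdorffMeasure_image_le (d := n) (Nat.cast_nonneg n)
  rw [h1, Measure.smul_apply, Measure.smul_apply, ENNReal.smul_def, ENNReal.smul_def, smul_eq_mul,
    smul_eq_mul, mul_left_comm]
  rw [ENNReal.rpow_natCast] at h2
  gcongr

/-- A map that is `K`-Lipschitz after conjugation with an injective linear map `T` increases volumes
by a factor of at most `K ^ n`, since the determinant of `T` cancels. -/
theorem volume_le_of_conjugate_lipschitz {n : ℕ} {K : NNReal}
    {T : EuclideanSpace ℝ (Fin n) →ₗ[ℝ] EuclideanSpace ℝ (Fin n)} (hT : Function.Injective T)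
    {s : Set (EuclideanSpace ℝ (Fin n))}
    {f : EuclideanSpace ℝ (Fin n) → EuclideanSpace ℝ (Fin n)}
    (hf : ∀ x ∈ s, ∀ x' ∈ s, ‖T (f x - f x')‖ ≤ K * ‖T (x - x')‖) :
    volume (f '' s) ≤ (K : ENNReal) ^ n * volume s := by
  have hdet : LinearMap.det T ≠ 0 := by
    rw [← isUnit_iff_ne_zero, ← LinearMap.isUnit_iff_isUnit_det, LinearMap.isUnit_iff_ker_eq_bot]
    exact LinearMap.ker_eq_bot.2 hT
  set e := LinearEquiv.ofInjectiveEndo T hT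
  have he (x) : e x = T x := rfl
  have hl : LipschitzOnWith K (fun z => T (f (e.symm z))) (T '' s) := by
    refine LipschitzOnWith.of_dist_le_mul ?_
    rintro _ ⟨x, hx, rfl⟩ _ ⟨x', hx', rfl⟩
    have h1 (x) : e.symm (T x) = x := e.symm_apply_apply x
    rw [h1, h1, dist_eq_norm, dist_eq_norm, ← map_sub, ← map_sub]
    exact hf x hx x' hx'
  have h1 := volume_image_le_of_lipschitzOnWith hl
  have h2 : (fun z => T (f (e.symm z))) '' (T '' s) = T '' (f '' s) := by
    rw [image_image, image_image]
    refine image_congr fun x _ => ?_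
    have : e.symm (T x) = x := e.symm_apply_apply x
    rw [this]
  rw [h2, Measure.addHaar_image_linearMap, Measure.addHaar_image_linearMap, mul_left_comm] at h1
  exact (ENNReal.mul_le_mul_iff_right (by simpa using hdet) ENNReal.ofReal_ne_top).1 h1

/-- Volume bound for a relation `G` which near each of its points is `K`-Lipschitz in some linear
coordinates; the coordinates may vary from point to point without control. No measurability of the
domain or the range of `G` is needed. -/
theorem volume_le_of_locally_conjugate_lipschitz {n : ℕ} {K : NNReal}
    {G : EuclideanSpace ℝ (Fin n) → EuclideanSpace ℝ (Fin n) → Prop}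
    (hG : ∀ xb yb, G xb yb → ∃ T : EuclideanSpace ℝ (Fin n) →ₗ[ℝ] EuclideanSpace ℝ (Fin n),
      Function.Injective T ∧ ∃ ρ > 0, ∀ x₀ y₀ x₁ y₁, G x₀ y₀ → dist x₀ xb ≤ ρ →
        G x₁ y₁ → dist x₁ xb ≤ ρ → ‖T (y₁ - y₀)‖ ≤ K * ‖T (x₁ - x₀)‖) :
    volume {y | ∃ x, G x y} ≤ (K : ENNReal) ^ n * volume {x | ∃ y, G x y} := by
  classical
  set E := {x | ∃ y, G x y} with hE
  have hsel : ∀ x, ∃ y, x ∈ E → G x y := fun x => by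
    by_cases hx : x ∈ E
    · exact ⟨hx.choose, fun _ => hx.choose_spec⟩
    · exact ⟨0, fun h => absurd h hx⟩
  choose F hF using hsel
  have hloc : ∀ x ∈ E, ∃ T : EuclideanSpace ℝ (Fin n) →ₗ[ℝ] EuclideanSpace ℝ (Fin n),
      Function.Injective T ∧ ∃ ρ > 0, ∀ x₀ y₀ x₁ y₁, G x₀ y₀ → dist x₀ x ≤ ρ →
        G x₁ y₁ → dist x₁ x ≤ ρ → ‖T (y₁ - y₀)‖ ≤ K * ‖T (x₁ - x₀)‖ :=
    fun x hx => hG x (F x) (hF x hx)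
  choose! T hT ρ hρ hlip using hloc
  have huniq : ∀ x y, G x y → y = F x := by
    intro x y hxy
    have hx : x ∈ E := ⟨y, hxy⟩
    have := hlip x hx x (F x) x y (hF x hx) (by simpa using (hρ x hx).le) hxy
      (by simpa using (hρ x hx).le)
    rw [sub_self, map_zero, norm_zero, mul_zero, norm_le_zero_iff, ← map_zero (T x)] at this
    exact sub_eq_zero.1 (hT x hx this)
  have himage : {y | ∃ x, G x y} ⊆ F '' E := by
    rintro y ⟨x, hxy⟩
    exact ⟨x, ⟨y, hxy⟩, (huniq x y hxy).symm⟩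
  obtain ⟨t, htE, htc, hcov⟩ := TopologicalSpace.countable_cover_nhdsWithin
    (f := fun x => Metric.closedBall x (ρ x)) (s := E)
    fun x hx => mem_nhdsWithin_of_mem_nhds (Metric.closedBall_mem_nhds x (hρ x hx))
  rcases t.eq_empty_or_nonempty with rfl | hne
  · have : E = ∅ := by simpa using hcov
    rw [this, image_empty] at himage
    rw [measure_mono_null himage measure_empty]
    exact zero_le
  obtain ⟨g, rfl⟩ := htc.exists_eq_range hne
  set Q : ℕ → Set (EuclideanSpace ℝ (Fin n)) :=
    disjointed fun k => Metric.closedBall (g k) (ρ (g k)) with hQ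
  have hQm (k : ℕ) : MeasurableSet (Q k) :=
    MeasurableSet.disjointed (fun k => Metric.isClosed_closedBall.measurableSet) k
  have hQd : Pairwise (Function.onFun Disjoint Q) := disjoint_disjointed _
  have hEQ : E = ⋃ k, Q k ∩ E := by
    rw [← iUnion_inter, hQ, iUnion_disjointed, eq_comm, inter_eq_right]
    simpa using hcov
  have hpiece (k : ℕ) : volume (F '' (Q k ∩ E)) ≤ (K : ENNReal) ^ n * volume (Q k ∩ E) := by
    have hk : g k ∈ E := htE ⟨k, rfl⟩
    refine volume_le_of_conjugate_lipschitz (hT (g k) hk) fun x hx x' hx' => ?_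
    exact hlip (g k) hk x' (F x') x (F x) (hF x' hx'.2) (disjointed_subset _ k hx'.1)
      (hF x hx.2) (disjointed_subset _ k hx.1)
  calc volume {y | ∃ x, G x y} ≤ volume (F '' E) := measure_mono himage
    _ = volume (⋃ k, F '' (Q k ∩ E)) := by rw [← image_iUnion, ← hEQ]
    _ ≤ ∑' k, volume (F '' (Q k ∩ E)) := measure_iUnion_le _
    _ ≤ ∑' k, (K : ENNReal) ^ n * volume (Q k ∩ E) := ENNReal.tsum_le_tsum hpiece
    _ = (K : ENNReal) ^ n * ∑' k, (volume.restrict E) (Q k) := by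
        rw [ENNReal.tsum_mul_left]; simp only [Measure.restrict_apply (hQm _)]
    _ = (K : ENNReal) ^ n * volume.restrict E (⋃ k, Q k) := by
        rw [measure_iUnion hQd hQm]
    _ ≤ (K : ENNReal) ^ n * volume E := by
        refine mul_le_mul' le_rfl ?_
        exact (measure_mono (subset_univ _)).trans_eq (Measure.restrict_apply_univ E)

/-! ### The measure estimate -/

section touching
variable {n : ℕ} {p L : Fin n → ℝ} {η B τ : ℝ} {h σ : Fin n → ℝ → ℝ}
  {v : EuclideanSpace ℝ (Fin n) → ℝ} {xs x y : EuclideanSpace ℝ (Fin n)}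

theorem add_sum_profile_le (H : ∀ i, IsProfile (p i) η B (h i) (σ i)) (hB : 0 < B) (hτ1 : τ ≤ 1)
    (hτ : n * (2 * B + 1) * 2 * τ ≤ 1 / 2) (hxs : ∀ i, |xs i| ≤ τ) (hvs : v xs ≤ 1)
    (hy : ∀ i, |y i| ≤ τ) : v xs + ∑ i, h i (xs i - y i) ≤ 3 / 2 := by
  have h1 : ∑ i, h i (xs i - y i) ≤ ∑ _i : Fin n, (2 * B + 1) * (2 * τ) := by
    refine Finset.sum_le_sum fun i _ => ?_
    have h2 : |xs i - y i| ≤ 2 * τ := (abs_sub _ _).trans (by linarith [hxs i, hy i])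
    refine ((H i).le_mul_abs (h2.trans (by linarith))).trans ?_
    gcongr
  rw [Finset.sum_const, Finset.card_univ, Fintype.card_fin, nsmul_eq_mul] at h1
  linarith

/-- Every centre `y` near the origin has a contact point: outside the box some profile is at least `4`,
while at `xs` the sum of `v` and the profile is at most `3 / 2`. -/
theorem exists_isContactPair (H : ∀ i, IsProfile (p i) η B (h i) (σ i))
    (h4 : ∀ i t, L i / 2 ≤ |t| → 4 ≤ h i t) (hB : 0 < B) (hτ1 : τ ≤ 1)
    (hv : Continuous v) (hv0 : ∀ x, 0 ≤ v x) (hL : ∀ i, 0 < L i) (hτL : ∀ i, 8 * τ ≤ L i)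
    (hτ : n * (2 * B + 1) * 2 * τ ≤ 1 / 2) (hxs : ∀ i, |xs i| ≤ τ) (hvs : v xs ≤ 1)
    (hy : ∀ i, |y i| ≤ τ) : ∃ x, IsContactPair h v x y := by
  have hcont : Continuous fun x : EuclideanSpace ℝ (Fin n) => v x + ∑ i, h i (x i - y i) :=
    hv.add (continuous_finsetSum _ fun i _ =>
      (H i).continuous.comp ((continuous_coord i).sub continuous_const))
  have hxsL : xs ∈ centeredBox L := fun i => (hxs i).trans (by linarith [hτL i, hL i])
  obtain ⟨x, hx, hmin⟩ := (isCompact_centeredBox L).exists_isMinOn ⟨xs, hxsL⟩ hcont.continuousOn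
  refine ⟨x, fun z => ?_⟩
  by_cases hz : z ∈ centeredBox L
  · exact hmin hz
  · have h1 : v x + ∑ i, h i (x i - y i) ≤ v xs + ∑ i, h i (xs i - y i) := hmin hxsL
    have h2 := add_sum_profile_le H hB hτ1 hτ hxs hvs hy
    obtain ⟨i, hi⟩ : ∃ i, L i < |z i| := by simpa [centeredBox] using hz
    have h3 : 4 ≤ h i (z i - y i) := by
      refine h4 i _ ?_
      have := abs_sub_abs_le_abs_sub (z i) (y i)
      linarith [hτL i, hy i, hL i]
    have h5 : h i (z i - y i) ≤ ∑ i, h i (z i - y i) :=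
      Finset.single_le_sum (f := fun i => h i (z i - y i)) (fun j _ => (H j).nonneg _)
        (Finset.mem_univ i)
    linarith [hv0 z]

theorem IsContactPair.bounds (H : ∀ i, IsProfile (p i) η B (h i) (σ i))
    (h4 : ∀ i t, L i / 2 ≤ |t| → 4 ≤ h i t) (hB : 0 < B) (hτ1 : τ ≤ 1)
    (hv0 : ∀ x, 0 ≤ v x)
    (hτ : n * (2 * B + 1) * 2 * τ ≤ 1 / 2) (hxs : ∀ i, |xs i| ≤ τ) (hvs : v xs ≤ 1)
    (hy : ∀ i, |y i| ≤ τ) (hc : IsContactPair h v x y) :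
    v x ≤ 3 / 2 ∧ ∀ i, |x i - y i| < L i / 2 := by
  have h1 := (hc xs).trans (add_sum_profile_le H hB hτ1 hτ hxs hvs hy)
  have h2 : 0 ≤ ∑ i, h i (x i - y i) := Finset.sum_nonneg fun j _ => (H j).nonneg _
  refine ⟨by linarith, fun i => ?_⟩
  by_contra! hi
  have h3 := h4 i _ hi
  have h5 : h i (x i - y i) ≤ ∑ i, h i (x i - y i) :=
    Finset.single_le_sum (f := fun i => h i (x i - y i)) (fun j _ => (H j).nonneg _)
      (Finset.mem_univ i)
  linarith [hv0 x]

end touching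

/-- The measure estimate for the box with half-widths `L i`. The constant `8 a R` depends on the
structural data only; the scale `η` of the inf-convolution, which depends on the modulus of continuity
of `u`, does not enter it. -/
theorem volume_box_le_volume_sublevel {n : ℕ} {p L : Fin n → ℝ} {lam Lam ε B a R τ : ℝ}
    (hp : ∀ i, 2 ≤ p i) (hlam : 0 < lam) (hLam : lam ≤ Lam) (hL : ∀ i, 0 < L i)
    (hL1 : ∀ i, L i ≤ 1) (hB : 0 < B)
    (hBL : ∀ i, 4 * (16 / L i) * ((16 / L i) ^ (p i - 2) + 1) ≤ L i * B)
    (hR1 : 1 ≤ R) (hR : R ^ 2 = 25 * a)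
    (ha : (ε + Lam * ∑ i, (2 * B + 2) ^ (p i - 1) + (Lam - lam) * (n * (8 * B))) / lam + n <
      a * B - 8 * n * B)
    (hτ1 : τ ≤ 1) (hτL : ∀ i, 8 * τ ≤ L i) (hτ : n * (2 * B + 1) * 2 * τ ≤ 1 / 2)
    {u : EuclideanSpace ℝ (Fin n) → ℝ} (hu : ContinuousOn u (centeredBox L))
    (hu0 : ∀ x ∈ centeredBox L, 0 ≤ u x)
    (hsuper : IsViscositySupersolution p lam Lam Lam ε (interior (centeredBox L)) u)
    {xs : EuclideanSpace ℝ (Fin n)} (hxs : ∀ i, |xs i| ≤ τ) (hus : u xs ≤ 1) :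
    volume (centeredBox fun _ : Fin n => τ) ≤
      ENNReal.ofReal (8 * a * R) ^ n * volume ({x | u x < 3} ∩ centeredBox L) := by
  have hK := isCompact_centeredBox L
  have hK0 : (centeredBox L).Nonempty := ⟨0, fun i => by simpa using (hL i).le⟩
  have ha0 : 0 < a := by nlinarith
  have hxsL : xs ∈ centeredBox L := fun i => (hxs i).trans (by linarith [hτL i, hL i])
  -- the scale of the inf-convolution
  obtain ⟨d, hd, hunif⟩ := Metric.uniformContinuousOn_iff.1
    (hK.uniformContinuousOn_of_continuous hu) (1 / 2) (by norm_num)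
  obtain ⟨η, ⟨⟨hη1, hηL⟩, hηd⟩, hη⟩ := ((((eventually_mul_le 1 one_pos).and
    (eventually_all.2 fun i => eventually_mul_le 4
      (show 0 < (L i / 16) ^ 2 by have := hL i; positivity))).and
    (eventually_mul_le 4 (show 0 < (d / 2) ^ 2 by positivity))).and self_mem_nhdsWithin).exists
  rw [one_mul] at hη1
  replace hη : 0 < η := hη
  choose h σ H h4 using fun i => exists_isProfile (hp i) hη hη1 hB (hL i) (hBL i)
  set v := infConv (centeredBox L) u η with hvdef
  have hv : Continuous v := continuous_infConv hK hu
  have hv0 : ∀ x, 0 ≤ v x := infConv_nonneg hη hu0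
  have hvs : v xs ≤ 1 := (infConv_le_self hK hu hxsL).trans hus
  have htr := hasTraceBound_infConv (T := 8 * B) (S := 2 * B + 2) hp hlam hLam (by positivity) hη
    hL hηL hu hu0 hsuper
  have hsc : ∀ x₀, ∃ c, ∀ x, v x ≤ v x₀ + inner ℝ c (x - x₀) + η⁻¹ / 2 * ‖x - x₀‖ ^ 2 := by
    intro x₀
    obtain ⟨z, hz, hzx⟩ := exists_infConv_eq (η := η) hK hK0 hu x₀
    exact ⟨_, infConv_le_paraboloid hK hu hη hz hzx⟩
  set G : EuclideanSpace ℝ (Fin n) → EuclideanSpace ℝ (Fin n) → Prop :=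
    fun x y => IsContactPair h v x y ∧ ∀ i, |y i| ≤ τ with hG
  have hGb {x y : EuclideanSpace ℝ (Fin n)} (hxy : G x y) :
      v x ≤ 3 / 2 ∧ ∀ i, |x i - y i| < L i / 2 :=
    hxy.1.bounds H h4 hB hτ1 hv0 hτ hxs hvs hxy.2
  have hG2 {x y : EuclideanSpace ℝ (Fin n)} (hxy : G x y) (i : Fin n) : |x i - y i| ≤ 2 := by
    linarith [(hGb hxy).2 i, hL1 i]
  have hGx {x y : EuclideanSpace ℝ (Fin n)} (hxy : G x y) (i : Fin n) :
      |x i| < 7 / 8 * L i := by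
    have h1 := abs_sub_abs_le_abs_sub (x i) (y i)
    linarith [(hGb hxy).2 i, hxy.2 i, hτL i, hL i]
  have hvol := volume_le_of_locally_conjugate_lipschitz (K := (8 * a * R).toNNReal) (G := G) ?_
  · have h1 : centeredBox (fun _ : Fin n => τ) ⊆ {y | ∃ x, G x y} := by
      intro y hy
      obtain ⟨x, hx⟩ := exists_isContactPair H h4 hB hτ1 hv hv0 hL hτL hτ hxs hvs hy
      exact ⟨x, hx, hy⟩
    have h2 : {x | ∃ y, G x y} ⊆ {x | u x < 3} ∩ centeredBox L := by
      rintro x ⟨y, hxy⟩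
      have hxL : x ∈ centeredBox L := fun i => (hGx hxy i).le.trans (by linarith [hL i])
      refine ⟨?_, hxL⟩
      obtain ⟨z, hz, hzx⟩ := exists_infConv_eq (η := η) hK hK0 hu x
      rw [← hvdef] at hzx
      have h3 := (hGb hxy).1
      have h5 : ‖x - z‖ ^ 2 / (2 * η) ≤ 2 := by linarith [hu0 z hz]
      rw [div_le_iff₀ (by positivity)] at h5
      have h6 : ‖x - z‖ ≤ d / 2 :=
        le_of_sq_le_sq (by linarith) (by positivity)
      have h7 := hunif x hxL z hz (by rw [dist_eq_norm]; linarith)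
      rw [Real.dist_eq] at h7
      have h8 := (abs_lt.1 h7).2
      have h9 : 0 ≤ ‖x - z‖ ^ 2 / (2 * η) := by positivity
      change u x < 3
      linarith
    calc volume (centeredBox fun _ : Fin n => τ) ≤ volume {y | ∃ x, G x y} := measure_mono h1
      _ ≤ _ := hvol
      _ ≤ _ := mul_le_mul' le_rfl (measure_mono h2)
  · intro xb yb hb
    have hΩ : {x : EuclideanSpace ℝ (Fin n) | ∀ i, |x i| ≤ 7 / 8 * L i} ∈ 𝓝 xb :=
      mem_interior_iff_mem_nhds.1 (mem_interior_centeredBox (L := fun i => 7 / 8 * L i) (hGx hb))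
    obtain ⟨V, hV, ρ, hρ, hlip⟩ := exists_rescale_lipschitz hp hη hη1 hB H hv hsc htr hR1 hR ha hΩ
      (lt_of_le_of_lt (hGb hb).1 (by norm_num)) hb.1 (hG2 hb)
    refine ⟨rescale V, rescale_injective hV, ρ, hρ, fun x₀ y₀ x₁ y₁ h₀ hd₀ h₁ hd₁ => ?_⟩
    rw [Real.coe_toNNReal _ (by positivity)]
    exact hlip x₀ y₀ x₁ y₁ h₀.1 (hG2 h₀) hd₀ h₁.1 (hG2 h₁) hd₁

theorem le_lastExponent {n : ℕ} [NeZero n] {p : Fin n → ℝ} (hp : Monotone p) (i : Fin n) :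
    p i ≤ lastExponent p :=
  hp (Fin.le_def.2 (Nat.le_sub_one_of_lt i.2))

theorem lemma3p1 (n : ℕ) [NeZero n] (p : Fin n → ℝ) (hp : Monotone p) (hp2 : ∀ i, 2 ≤ p i)
    (lam Lam : ℝ) (hlam : 0 < lam) (hLam : lam ≤ Lam) (ε : ℝ) (hε : 0 < ε) :
    ∃ r₀ M₀ δ₀ : ℝ, 0 < r₀ ∧ r₀ < 1 ∧ 1 < M₀ ∧ 0 < δ₀ ∧ δ₀ < 1 ∧
      intrinsicCube p r₀ 1 ⊆ intrinsicCube p 1 M₀ ∧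
      ∀ u : EuclideanSpace ℝ (Fin n) → ℝ,
        ContinuousOn u (intrinsicCube p 1 M₀) →
        (∀ x ∈ intrinsicCube p 1 M₀, 0 ≤ u x) →
        IsViscositySupersolution p lam Lam Lam ε (interior (intrinsicCube p 1 M₀)) u →
        sInf (u '' intrinsicCube p r₀ 1) ≤ 1 →
        ENNReal.ofReal δ₀ * MeasureTheory.volume (intrinsicCube p 1 M₀) ≤
          MeasureTheory.volume ({x | u x < M₀} ∩ intrinsicCube p 1 M₀) := by
  set L : Fin n → ℝ := fun i => (1 : ℝ) ^ (1 / p i) * 3 ^ (-((lastExponent p - p i) / p i))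
    with hLdef
  have hp0 (i : Fin n) : 0 < p i := by linarith [hp2 i]
  have hL (i : Fin n) : 0 < L i := by positivity
  have hL1 (i : Fin n) : L i ≤ 1 := by
    simp only [hLdef, Real.one_rpow, one_mul]
    refine Real.rpow_le_one_of_one_le_of_nonpos (by norm_num) ?_
    have := div_nonneg (sub_nonneg.2 (le_lastExponent hp i)) (hp0 i).le
    linarith
  -- `B` makes the profiles high, `a` makes the barrier violate the trace bound
  set β : Fin n → ℝ := fun i => 4 * (16 / L i) * ((16 / L i) ^ (p i - 2) + 1) / L i with hβ
  have hβ0 (i : Fin n) : 0 ≤ β i := by have := hL i; positivity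
  set B : ℝ := 1 + ∑ i, β i with hBdef
  have hB : 0 < B := by have := Finset.sum_nonneg fun i (_ : i ∈ Finset.univ) => hβ0 i; linarith
  have hBL (i : Fin n) : 4 * (16 / L i) * ((16 / L i) ^ (p i - 2) + 1) ≤ L i * B := by
    have h1 : β i ≤ B := by
      have := Finset.single_le_sum (fun j _ => hβ0 j) (Finset.mem_univ i)
      linarith
    rw [hβ, div_le_iff₀ (hL i)] at h1
    linarith
  set C : ℝ := (ε + Lam * ∑ i, (2 * B + 2) ^ (p i - 1) + (Lam - lam) * (n * (8 * B))) / lam + n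
    with hC
  set a : ℝ := |C| / B + 8 * n + 1 with hadef
  have ha1 : 1 ≤ a := by
    have : 0 ≤ |C| / B + 8 * n := by positivity
    linarith
  have ha : C < a * B - 8 * n * B := by
    have h1 : a * B - 8 * n * B = |C| + B := by rw [hadef]; field_simp; ring
    rw [h1]; linarith [le_abs_self C]
  set R : ℝ := 5 * √a with hRdef
  have hR : R ^ 2 = 25 * a := by rw [hRdef, mul_pow, Real.sq_sqrt (by linarith)]; norm_num
  have hR1 : 1 ≤ R := by nlinarith [Real.sqrt_nonneg a]
  -- `τ` bounds the coordinates of the centres and of the points of `intrinsicCube p r₀ 1`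
  obtain ⟨τ, ⟨⟨hτL, hτ⟩, hτ1⟩, hτ0⟩ := ((((eventually_all.2 fun i =>
    eventually_mul_le 8 (hL i)).and (eventually_mul_le (n * (2 * B + 1) * 2) one_half_pos)).and
    (eventually_mul_le 2 one_pos)).and self_mem_nhdsWithin).exists
  replace hτ0 : 0 < τ := hτ0
  replace hτ1 : τ < 1 := by linarith
  have hlast : 0 < lastExponent p := hp0 _
  set r₀ : ℝ := τ ^ lastExponent p with hr₀
  have hcube : intrinsicCube p r₀ 1 ⊆ centeredBox fun _ => τ := by
    intro x hx i
    refine (hx i).trans ?_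
    rw [Real.one_rpow, mul_one, hr₀, ← Real.rpow_mul hτ0.le]
    refine (Real.rpow_le_rpow_of_exponent_ge hτ0 hτ1.le (y := lastExponent p * (1 / p i))
      (z := 1) ?_).trans_eq (Real.rpow_one τ)
    rw [mul_one_div, one_le_div (hp0 i)]
    exact le_lastExponent hp i
  set κ : ENNReal := ENNReal.ofReal (8 * a * R) ^ n with hκ
  have hκ0 : κ ≠ 0 := by
    refine pow_ne_zero _ ?_
    have : 0 < 8 * a * R := by positivity
    simpa using this
  have hκt : κ ≠ ⊤ := ENNReal.pow_ne_top ENNReal.ofReal_ne_top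
  have hvt : volume (centeredBox L) ≠ ⊤ := (isCompact_centeredBox L).measure_lt_top.ne
  have hvτ : 0 < volume (centeredBox fun _ : Fin n => τ) :=
    Measure.measure_pos_of_nonempty_interior _ ⟨0, mem_interior_centeredBox (by simpa using hτ0)⟩
  obtain ⟨δ, hδ0, hδ⟩ := ENNReal.lt_iff_exists_nnreal_btwn.1
    (show 0 < min (volume (centeredBox fun _ : Fin n => τ) / (κ * volume (centeredBox L))) 1 from
      lt_min (ENNReal.div_pos hvτ.ne' (ENNReal.mul_ne_top hκt hvt)) one_pos)
  refine ⟨r₀, 3, δ, Real.rpow_pos_of_pos hτ0 _, Real.rpow_lt_one hτ0.le hτ1 hlast, by norm_num,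
    by exact_mod_cast hδ0, by exact_mod_cast hδ.trans_le (min_le_right _ _), ?_, ?_⟩
  · intro x hx i
    exact (hcube hx i).trans (by have := hτL i; have := hL i; linarith)
  intro u hu hu0 hsuper hinf
  obtain ⟨xs, hxs, hus⟩ : ∃ xs ∈ intrinsicCube p r₀ 1, u xs ≤ 1 := by
    have hsub : intrinsicCube p r₀ 1 ⊆ intrinsicCube p 1 3 := fun x hx i =>
      (hcube hx i).trans (by have := hτL i; have := hL i; linarith)
    have hcpt : IsCompact (intrinsicCube p r₀ 1) := isCompact_centeredBox _
    have hne : (intrinsicCube p r₀ 1).Nonempty := ⟨0, fun i => by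
      have : 0 < r₀ := Real.rpow_pos_of_pos hτ0 _
      simp only [PiLp.zero_apply, abs_zero]; positivity⟩
    obtain ⟨x, hx, hxe⟩ := (hcpt.image_of_continuousOn (hu.mono hsub)).sInf_mem (hne.image _)
    exact ⟨x, hx, hxe.trans_le hinf⟩
  have hmain := volume_box_le_volume_sublevel hp2 hlam hLam hL hL1 hB hBL hR1 hR ha hτ1.le hτL hτ
    hu hu0 hsuper (hcube hxs) hus
  rw [← ENNReal.mul_le_mul_iff_right hκ0 hκt]
  refine le_trans ?_ hmain
  have h1 := ENNReal.mul_le_of_le_div (hδ.le.trans (min_le_left _ _))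
  rw [ENNReal.ofReal_coe_nnreal, mul_left_comm]
  exact h1
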